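/- Let $\Omega\subset\mathbb R^d$ be a bounded Lipschitz domain (open, connected, locally the region above the graph of a Lipschitz function) and $x_0\in\Omega$. Let $s_*,\bar s,\psi_i\in L^\infty(\Omega)$ ($i\ge 1$) with $s_*\ge 0$ a.e., put $b_i=\|\psi_i\|_{L^\infty(\Omega)}$, and assume $b_i<c_0\,i^{-p}$ for all $i$, with constants $c_0$ and $p>1$. Let $U=\{u\in\mathbb R^{\mathbb N}:\sum_i|u_i|b_i<\infty\}$ and let the prior $\gamma$ be the restriction to $U$ of $\bigotimes_{i\ge1}\mathcal N(0,1)$. For every $u\in U$ let $$s(x,u)=s_*(x)+\exp\Big(\bar s(x)+\sum_{i=1}^\infty u_i\psi_i(x)\Big)\quad\text{for a.e. }x\in\Omega,$$ and assume that $s(\cdot,u)$ is continuous on $\overline\Omega$. Let $T(\cdot,u)$ be the viscosity solution of the eikonal equation $|\nabla T(\cdot,u)|=s(\cdot,u)$ in $\Omega\setminus\{x_0\}$ with $T(x_0,u)=0$ and the Soner boundary condition $\nabla T\cdot n\ge0$ on $\partial\Omega$; that is, $T(\cdot,u)\in C(\overline\Omega)$ vanishes at $x_0$, is a viscosity subsolution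 in $\Omega\setminus\{x_0\}$ and is a viscosity supersolution on $\overline\Omega\setminus\{x_0\}$ (test functions touching from below relative to $\overline\Omega$). Let $x^1,\dots,x^N\in\overline\Omega$ and $G(u)=(T(x^1,u),\dots,T(x^N,u))$. Let $\Sigma$ be a positive definite $N\times N$ matrix, $|v|_\Sigma=|\Sigma^{-1/2}v|$, $\Phi(u,\delta)=\tfrac12|\delta-G(u)|_\Sigma^2$, $Z(\delta)=\int_U e^{-\Phi(u,\delta)}\,d\gamma(u)$, and let the posterior $\gamma^\delta$ be given by $$\frac{d\gamma^\delta}{d\gamma}(u)=\frac{1}{Z(\delta)}\,e^{-\Phi(u,\delta)} .$$ Then for every $u\in U$ the solution $T(\cdot,u)$ exists and is unique on $\overline\Omega$; every $\gamma^\delta$ is a probability measure, and $\delta\mapsto\gamma^\delta$ is a regular conditional law of $u$ given $\delta=G(u)+\vartheta$, where $u\sim\gamma$ and $\vartheta\sim\mathcal N(0,\Sigma)$ are independent; and the posterior is locally Lipschitz in the data in the Hellinger metric: for every $r$ there is a constant $c(r)$, independent of $\delta$ and $\delta'$, such that for all $\delta,\delta'\in\mathbb R^N$ with $|\delta|<r$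 and $|\delta'|<r$ (Euclidean norm), $$d_{\mathrm{Hell}}(\gamma^\delta,\gamma^{\delta'})\le c(r)\,|\delta-\delta'|_\Sigma,$$ where $$d_{\mathrm{Hell}}(\gamma^\delta,\gamma^{\delta'})^2=\frac12\int_U\Big(\sqrt{\tfrac{d\gamma^\delta}{d\gamma}}-\sqrt{\tfrac{d\gamma^{\delta'}}{d\gamma}}\Big)^2d\gamma .$$ -/

import Mathlib

open MeasureTheory ProbabilityTheory
open scoped ENNReal

namespace LogNormalEikonal

/-- An open connected set is a Lipschitz domain if, near each of its boundary points `z` and in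
suitable rotated coordinates (`e` is the vertical unit vector), it is the region strictly above
the graph of a Lipschitz function. The argument of `g` is the orthogonal projection of `y` on the
hyperplane orthogonal to `e`. -/
structure IsLipschitzDomain {d : ℕ} (Ω : Set (EuclideanSpace ℝ (Fin d))) : Prop where
  isOpen : IsOpen Ω
  isConnected : IsConnected Ω
  boundary : ∀ z ∈ frontier Ω,
    ∃ (e : EuclideanSpace ℝ (Fin d)) (g : EuclideanSpace ℝ (Fin d) → ℝ) (K : NNReal) (ρ : ℝ),
      ‖e‖ = 1 ∧ LipschitzWith K g ∧ 0 < ρ ∧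
        ∀ y ∈ Metric.ball z ρ, y ∈ Ω ↔ g (y - inner ℝ e y • e) < inner ℝ e y

/-- Viscosity solutions of `|∇T| = s` in `Ω \ {x₀}`, `T(x₀) = 0`, with the Soner boundary condition
`∇T · n ≥ 0` on `∂Ω`: `T` is continuous on the closure of `Ω`, is a viscosity subsolution in
`Ω \ {x₀}`, and is a viscosity supersolution on `closure Ω \ {x₀}`, up to the boundary.
Only the values of `s` and `T` on `closure Ω` matter. -/
structure IsEikonalSolution {d : ℕ} (Ω : Set (EuclideanSpace ℝ (Fin d)))
    (x₀ : EuclideanSpace ℝ (Fin d)) (s T : EuclideanSpace ℝ (Fin d) → ℝ) : Prop where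
  continuousOn : ContinuousOn T (closure Ω)
  source : T x₀ = 0
  subsolution : ∀ φ : EuclideanSpace ℝ (Fin d) → ℝ, ContDiff ℝ 1 φ →
    ∀ x ∈ Ω \ {x₀}, IsLocalMax (fun y => T y - φ y) x → ‖gradient φ x‖ ≤ s x
  supersolution : ∀ φ : EuclideanSpace ℝ (Fin d) → ℝ, ContDiff ℝ 1 φ →
    ∀ x ∈ closure Ω \ {x₀}, IsLocalMinOn (fun y => T y - φ y) (closure Ω) x →
      s x ≤ ‖gradient φ x‖

/-- The norm of `f` in `L^∞(Ω)`. -/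
noncomputable def supNorm {d : ℕ} (Ω : Set (EuclideanSpace ℝ (Fin d)))
    (f : EuclideanSpace ℝ (Fin d) → ℝ) : ℝ :=
  (eLpNorm f ∞ (volume.restrict Ω)).toReal

/-- The parameter space `U` of all real sequences `u` with `∑ |uᵢ| ‖ψᵢ‖_{L^∞(Ω)} < ∞`. -/
def paramSpace {d : ℕ} (Ω : Set (EuclideanSpace ℝ (Fin d)))
    (ψ : ℕ → EuclideanSpace ℝ (Fin d) → ℝ) : Set (ℕ → ℝ) :=
  {u | Summable fun i => |u i| * supNorm Ω (ψ i)}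

theorem measurableSet_paramSpace {d : ℕ} (Ω : Set (EuclideanSpace ℝ (Fin d)))
    (ψ : ℕ → EuclideanSpace ℝ (Fin d) → ℝ) : MeasurableSet (paramSpace Ω ψ) := by
  have h : paramSpace Ω ψ =
      {u : ℕ → ℝ | ∑' i, ENNReal.ofReal (|u i| * supNorm Ω (ψ i)) ≠ ∞} := by
    ext u
    have h0 : ∀ i, 0 ≤ |u i| * supNorm Ω (ψ i) := fun i =>
      mul_nonneg (abs_nonneg _) ENNReal.toReal_nonneg
    constructor
    · intro hu
      exact Summable.tsum_ofReal_ne_top hu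
    · intro hu
      have := ENNReal.summable_toReal hu
      simpa only [paramSpace, Set.mem_setOf_eq, ENNReal.toReal_ofReal (h0 _)] using this
  rw [h]
  have hm : Measurable fun u : ℕ → ℝ => ∑' i, ENNReal.ofReal (|u i| * supNorm Ω (ψ i)) := by
    refine Measurable.tsum fun i => ?_
    exact (((measurable_pi_apply i).abs).mul_const _).ennreal_ofReal
  exact (hm (measurableSet_singleton _)).compl

/-- The prior: the restriction to `U` of the countable product of the standard normal laws. -/
noncomputable def prior {d : ℕ} (Ω : Set (EuclideanSpace ℝ (Fin d)))
    (ψ : ℕ → EuclideanSpace ℝ (Fin d) → ℝ) : Measure (paramSpace Ω ψ) :=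
  (Measure.infinitePi fun _ : ℕ => gaussianReal 0 1).comap Subtype.val

/-- The weighted norm `|v|_Σ = |Σ^{-1/2} v| = (vᵀ Σ⁻¹ v)^{1/2}`, for `Σ = S` positive definite. -/
noncomputable def covNorm {N : ℕ} (S : Matrix (Fin N) (Fin N) ℝ)
    (v : EuclideanSpace ℝ (Fin N)) : ℝ :=
  Real.sqrt (v.ofLp ⬝ᵥ S⁻¹.mulVec v.ofLp)

/-- The mismatch function `Φ(u, δ) = |δ - G(u)|_Σ² / 2`. -/
noncomputable def misfit {U : Type*} {N : ℕ} (S : Matrix (Fin N) (Fin N) ℝ)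
    (G : U → EuclideanSpace ℝ (Fin N)) (u : U) (δ : EuclideanSpace ℝ (Fin N)) : ℝ :=
  covNorm S (δ - G u) ^ 2 / 2

/-- The normalising constant `Z(δ)`. -/
noncomputable def normConst {U : Type*} [MeasurableSpace U] (γ : Measure U) {N : ℕ}
    (S : Matrix (Fin N) (Fin N) ℝ) (G : U → EuclideanSpace ℝ (Fin N))
    (δ : EuclideanSpace ℝ (Fin N)) : ℝ :=
  ∫ u, Real.exp (-misfit S G u δ) ∂γ

/-- The posterior `γ^δ`, with density `exp(-Φ(u, δ)) / Z(δ)` with respect to the prior `γ`. -/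
noncomputable def posteriorMeasure {U : Type*} [MeasurableSpace U] (γ : Measure U) {N : ℕ}
    (S : Matrix (Fin N) (Fin N) ℝ) (G : U → EuclideanSpace ℝ (Fin N))
    (δ : EuclideanSpace ℝ (Fin N)) : Measure U :=
  γ.withDensity fun u => ENNReal.ofReal (Real.exp (-misfit S G u δ) / normConst γ S G δ)

/-- `κ` is a regular conditional law of `u` given the observation `δ = G(u) + ϑ`, where `u` and the
noise `ϑ` are independent with laws `γ` and `ν`. -/
structure IsConditionalLaw {U : Type*} [MeasurableSpace U] (γ : Measure U) {N : ℕ}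
    (ν : Measure (EuclideanSpace ℝ (Fin N))) (G : U → EuclideanSpace ℝ (Fin N))
    (κ : EuclideanSpace ℝ (Fin N) → Measure U) : Prop where
  isProbabilityMeasure : ∀ δ, IsProbabilityMeasure (κ δ)
  measurable : Measurable κ
  disintegration : ∀ (A : Set U) (B : Set (EuclideanSpace ℝ (Fin N))),
    MeasurableSet A → MeasurableSet B →
      (γ.prod ν) {p | G p.1 + p.2 ∈ B ∧ p.1 ∈ A} =
        ∫⁻ p in {p | G p.1 + p.2 ∈ B}, κ (G p.1 + p.2) A ∂(γ.prod ν)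

/-- The Hellinger distance of two probability measures that are absolutely continuous with respect
to the reference measure `γ`. -/
noncomputable def hellingerDist {U : Type*} [MeasurableSpace U] (γ α β : Measure U) : ℝ :=
  Real.sqrt (1 / 2 *
    ∫ u, (Real.sqrt (α.rnDeriv γ u).toReal - Real.sqrt (β.rnDeriv γ u).toReal) ^ 2 ∂γ)

/-- The forward operator `G(u) = (T(x¹, u), …, T(xᴺ, u))`. -/
noncomputable def forwardMap {U : Type*} {d N : ℕ} (T : U → EuclideanSpace ℝ (Fin d) → ℝ)
    (x : Fin N → EuclideanSpace ℝ (Fin d)) (u : U) : EuclideanSpace ℝ (Fin N) :=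
  WithLp.toLp 2 fun i => T u (x i)

end LogNormalEikonal

open LogNormalEikonal

/-!
The proof has an analytic half, which makes the forward map a well-defined measurable function, and
a probabilistic half, which needs nothing else about it.

*Uniqueness.* A Lipschitz domain has interior cones (`IsLipschitzDomain.hasInteriorCones`). Doubling
variables with a penalty shifted along the axis of such a cone keeps the point at which the
subsolution is tested inside `Ω`, so sub- and supersolutions for the Soner boundary condition can be
compared when their slownesses are strictly ordered (`IsEikonalSolution.le_of_lt`). The equation is
positively homogeneous, and multiplying a solution by `θ < 1` removes the strictness
(`IsEikonalSolution.le_of_le`).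

*Existence.* The solution is the supremum of all continuous `w` with `w x₀ ≤ 0` that grow along
segments of `Ω` at most at the rate `s` (Perron's method, `isEikonalSolution_perronSolution`).
Interior cones make these competitors locally equi-Lipschitz up to the boundary, so the supremum is
continuous there; where the supersolution property failed, even at a boundary point, a competitor
could be raised (`IsSegmentSubsolution.bump`).

*Measurability.* Since `s_* ≥ 0`, changing `u` to `u'` multiplies `s` by a factor of at most
`exp (∑ |uᵢ - u'ᵢ| bᵢ)` (`slowness_le`), and by comparison the same holds for the travel times.
Hence `T` is the limit of its values at the truncations of `u`, and these values are continuous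
functions of finitely many coordinates (`measurable_solution`).

*Bayes' formula.* The noise has a density proportional to `exp (-|v|_Σ² / 2)` with respect to a
translation-invariant measure (`exists_multivariateGaussian_eq_withDensity`), and the conditional
law follows from Tonelli's theorem (`isConditionalLaw_posteriorMeasure`).

*Hellinger estimate.* The function `t ↦ exp (-t² / 4)` is `1`-Lipschitz, so the square root of the
likelihood, `exp (-Φ(u, δ) / 2)`, is `1`-Lipschitz in `δ` for `|·|_Σ`, uniformly in `u`; no
integrability of `G` is needed. The normalising constant is continuous and positive, hence bounded
below on bounded sets of data, and dividing by it preserves the Lipschitz bound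
(`hellingerDist_posteriorMeasure_le`).
-/

open LogNormalEikonal

namespace LogNormalEikonal

open Filter Topology

variable {d : ℕ} {Ω : Set (EuclideanSpace ℝ (Fin d))}

/-! ### Interior cones of Lipschitz domains -/

/-- `Ω` has the interior cone property if near each point `z` of its closure there is one truncated
open cone, spanned by the ball of radius `c` about `v`, whose translate to any nearby point of the
closure lies in `Ω`. At interior points `v = 0` is allowed. -/
def HasInteriorCones {E : Type*} [NormedAddCommGroup E] [NormedSpace ℝ E] (Ω : Set E) : Prop :=
  ∀ z ∈ closure Ω, ∃ (v : E) (c ρ : ℝ), 0 < c ∧ 0 < ρ ∧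
    ∀ y ∈ closure Ω, ‖y - z‖ < ρ → ∀ t : ℝ, 0 < t → t < ρ → ∀ w : E, ‖w - v‖ < c → y + t • w ∈ Ω

theorem IsLipschitzDomain.hasInteriorCones (hΩ : IsLipschitzDomain Ω) : HasInteriorCones Ω := by
  intro z hz
  by_cases hzΩ : z ∈ Ω
  · obtain ⟨r, hr, hball⟩ := Metric.isOpen_iff.1 hΩ.isOpen z hzΩ
    refine ⟨0, 1, r / 2, one_pos, by positivity, fun y _ hy t ht htr w hw => hball ?_⟩
    rw [sub_zero] at hw
    rw [Metric.mem_ball, dist_eq_norm]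
    calc ‖y + t • w - z‖ = ‖(y - z) + t • w‖ := by congr 1; abel
      _ ≤ ‖y - z‖ + ‖t • w‖ := norm_add_le _ _
      _ = ‖y - z‖ + t * ‖w‖ := by rw [norm_smul, Real.norm_of_nonneg ht.le]
      _ < r := by nlinarith
  · have hzf : z ∈ frontier Ω := by
      rw [hΩ.isOpen.frontier_eq]; exact ⟨hz, hzΩ⟩
    obtain ⟨e, g, K, ρ, he, hg, hρ, hgraph⟩ := hΩ.boundary z hzf
    have hK : (0 : ℝ) ≤ K := K.2
    have hee : inner ℝ e e = (1 : ℝ) := by rw [real_inner_self_eq_norm_sq, he]; norm_num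
    -- A step `t • w` with `‖w - e‖ < c` raises the height by at least `t * (1 - c)` and the graph
    -- below by at most `t * (2 * K * c)`, so `c * (1 + 2 * K) < 1` is what is needed.
    set c : ℝ := 1 / (2 + 2 * K) with hc
    have hc0 : 0 < c := by positivity
    have hc1 : c * (1 + 2 * K) < 1 := by
      rw [hc, div_mul_eq_mul_div, one_mul, div_lt_one (by positivity)]; linarith
    have hgc : Continuous g := hg.continuous
    refine ⟨e, c, ρ / 4, hc0, by positivity, fun y hy hyz t ht htr w hw => ?_⟩
    have hcle : c ≤ 1 := by nlinarith
    have hwn : ‖w‖ ≤ 2 := by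
      calc ‖w‖ = ‖(w - e) + e‖ := by congr 1; abel
        _ ≤ ‖w - e‖ + ‖e‖ := norm_add_le _ _
        _ ≤ 2 := by rw [he]; linarith
    have hball : y + t • w ∈ Metric.ball z ρ := by
      rw [Metric.mem_ball, dist_eq_norm]
      calc ‖y + t • w - z‖ = ‖(y - z) + t • w‖ := by congr 1; abel
        _ ≤ ‖y - z‖ + ‖t • w‖ := norm_add_le _ _
        _ = ‖y - z‖ + t * ‖w‖ := by rw [norm_smul, Real.norm_of_nonneg ht.le]
        _ < ρ := by nlinarith
    -- Points of the closure lie on or above the graph.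
    have hyg : g (y - inner ℝ e y • e) ≤ inner ℝ e y := by
      have hyb : y ∈ Metric.ball z ρ := by
        rw [Metric.mem_ball, dist_eq_norm]; linarith
      have hcl : y ∈ closure (Metric.ball z ρ ∩ Ω) :=
        Metric.isOpen_ball.inter_closure ⟨hyb, hy⟩
      refine closure_minimal (s := Metric.ball z ρ ∩ Ω)
        (t := {y | g (y - inner ℝ e y • e) ≤ inner ℝ e y}) ?_ ?_ hcl
      · rintro q ⟨hq, hqΩ⟩
        exact ((hgraph q hq).1 hqΩ).le
      · exact isClosed_le (by fun_prop) (by fun_prop)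
    refine (hgraph _ hball).2 ?_
    have hq : |inner ℝ e (w - e)| ≤ ‖w - e‖ := by
      simpa [he] using abs_real_inner_le_norm e (w - e)
    have hew : inner ℝ e w = 1 + inner ℝ e (w - e) := by rw [inner_sub_right, hee]; ring
    have hin : inner ℝ e (y + t • w) = inner ℝ e y + t * (1 + inner ℝ e (w - e)) := by
      rw [inner_add_right, inner_smul_right, hew]
    have hproj : (y + t • w - inner ℝ e (y + t • w) • e) - (y - inner ℝ e y • e)
        = t • ((w - e) - inner ℝ e (w - e) • e) := by
      rw [hin]; module
    have hdist : g (y + t • w - inner ℝ e (y + t • w) • e) - g (y - inner ℝ e y • e)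
        ≤ K * (t * (2 * ‖w - e‖)) := by
      refine (le_abs_self _).trans ?_
      have h1 := hg.dist_le_mul (y + t • w - inner ℝ e (y + t • w) • e) (y - inner ℝ e y • e)
      rw [Real.dist_eq, dist_eq_norm, hproj, norm_smul, Real.norm_of_nonneg ht.le] at h1
      refine h1.trans ?_
      gcongr
      calc ‖(w - e) - inner ℝ e (w - e) • e‖ ≤ ‖w - e‖ + ‖inner ℝ e (w - e) • e‖ := norm_sub_le _ _
        _ ≤ 2 * ‖w - e‖ := by
          rw [norm_smul, he, mul_one, Real.norm_eq_abs]; linarith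
    have hlow : -‖w - e‖ ≤ inner ℝ e (w - e) := (abs_le.1 hq).1
    rw [hin] at hdist ⊢
    have hfin : K * (2 * ‖w - e‖) < 1 + inner ℝ e (w - e) := by
      have : K * (2 * ‖w - e‖) ≤ K * (2 * c) := by gcongr
      nlinarith
    nlinarith [mul_lt_mul_of_pos_left hfin ht]

/-! ### Gradients of test functions -/

theorem norm_gradient (φ : EuclideanSpace ℝ (Fin d) → ℝ) (x : EuclideanSpace ℝ (Fin d)) :
    ‖gradient φ x‖ = ‖fderiv ℝ φ x‖ :=
  LinearIsometryEquiv.norm_map _ _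

theorem hasGradientAt_norm_sq_smul_sub (a : ℝ) (b v x : EuclideanSpace ℝ (Fin d)) :
    HasGradientAt (fun y => ‖a • (y - b) - v‖ ^ 2) ((2 * a) • (a • (x - b) - v)) x := by
  rw [hasGradientAt_iff_hasFDerivAt]
  have h : HasFDerivAt (fun y => a • (y - b) - v)
      (a • ContinuousLinearMap.id ℝ (EuclideanSpace ℝ (Fin d))) x :=
    (((hasFDerivAt_id x).sub_const b).const_smul a).sub_const v
  refine h.norm_sq.congr_fderiv ?_
  ext y
  simp
  ring

theorem contDiff_norm_sq_smul_sub (a : ℝ) (b v : EuclideanSpace ℝ (Fin d)) :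
    ContDiff ℝ 1 fun y => ‖a • (y - b) - v‖ ^ 2 :=
  ContDiff.norm_sq ℝ (by fun_prop)

theorem hasGradientAt_add {f g : EuclideanSpace ℝ (Fin d) → ℝ}
    {f' g' x : EuclideanSpace ℝ (Fin d)}
    (hf : HasGradientAt f f' x) (hg : HasGradientAt g g' x) :
    HasGradientAt (fun y => f y + g y) (f' + g') x := by
  rw [hasGradientAt_iff_hasFDerivAt] at *
  rw [map_add]
  exact hf.add hg

theorem hasGradientAt_neg {f : EuclideanSpace ℝ (Fin d) → ℝ} {f' x : EuclideanSpace ℝ (Fin d)}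
    (hf : HasGradientAt f f' x) : HasGradientAt (fun y => -f y) (-f') x := by
  rw [hasGradientAt_iff_hasFDerivAt] at *
  rw [map_neg]
  exact hf.neg

/-! ### Comparison and uniqueness -/

/-- Comparison for the Soner boundary condition, with a strict gap between the right-hand sides.
If `T₁ - T₂` were positive at its maximum point `z`, one would double the variables with the penalty
`‖(x - y) / ε - v‖² + ‖y - z‖²`. The shift `v`, the axis of the interior cone at `z`, forces the
maximum point `x` into the open set `Ω`, where the subsolution property is available. -/
theorem IsEikonalSolution.le_of_lt (hcone : HasInteriorCones Ω) (hopen : IsOpen Ω)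
    (hb : Bornology.IsBounded Ω) {x₀ : EuclideanSpace ℝ (Fin d)}
    {s₁ s₂ T₁ T₂ : EuclideanSpace ℝ (Fin d) → ℝ}
    (hs₁ : ContinuousOn s₁ (closure Ω)) (hs₂ : ContinuousOn s₂ (closure Ω))
    (hlt : ∀ x ∈ closure Ω, s₁ x < s₂ x)
    (h₁ : IsEikonalSolution Ω x₀ s₁ T₁) (h₂ : IsEikonalSolution Ω x₀ s₂ T₂) :
    ∀ x ∈ closure Ω, T₁ x ≤ T₂ x := by
  have hK : IsCompact (closure Ω) := hb.isCompact_closure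
  intro x hx
  by_contra! hneg
  obtain ⟨z, hz, hzmax⟩ := hK.exists_isMaxOn ⟨x, hx⟩ (h₁.continuousOn.sub h₂.continuousOn)
  have hzmax' : ∀ y ∈ closure Ω, T₁ y - T₂ y ≤ T₁ z - T₂ z := fun y hy => hzmax hy
  have hzx₀ : z ≠ x₀ := by
    rintro rfl
    have := hzmax' x hx
    rw [h₁.source, h₂.source] at this
    linarith
  obtain ⟨v, c, ρ, hc, hρ, hconez⟩ := hcone z hz
  obtain ⟨B, hB⟩ := (hK.image_of_continuousOn h₁.continuousOn).isBounded.exists_norm_le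
  replace hB : ∀ y ∈ closure Ω, |T₁ y| ≤ B := fun y hy => hB _ ⟨y, hy, rfl⟩
  have hB0 : 0 ≤ B := (abs_nonneg _).trans (hB z hz)
  have hmax : ∀ ε : ℝ, ∃ q : EuclideanSpace ℝ (Fin d) × EuclideanSpace ℝ (Fin d),
      q.1 ∈ closure Ω ∧ q.2 ∈ closure Ω ∧ ∀ x ∈ closure Ω, ∀ y ∈ closure Ω,
        T₁ x - T₂ y - ‖ε⁻¹ • (x - y) - v‖ ^ 2 - ‖y - z‖ ^ 2 ≤
          T₁ q.1 - T₂ q.2 - ‖ε⁻¹ • (q.1 - q.2) - v‖ ^ 2 - ‖q.2 - z‖ ^ 2 := by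
    intro ε
    have hc1 : ContinuousOn (fun q : EuclideanSpace ℝ (Fin d) × EuclideanSpace ℝ (Fin d) =>
        T₁ q.1 - T₂ q.2 - ‖ε⁻¹ • (q.1 - q.2) - v‖ ^ 2 - ‖q.2 - z‖ ^ 2)
        (closure Ω ×ˢ closure Ω) := by
      refine ((ContinuousOn.sub ?_ ?_).sub ?_).sub ?_
      · exact h₁.continuousOn.comp continuousOn_fst fun q hq => hq.1
      · exact h₂.continuousOn.comp continuousOn_snd fun q hq => hq.2
      · fun_prop
      · fun_prop
    obtain ⟨q, hq, hqmax⟩ := (hK.prod hK).exists_isMaxOn ⟨(z, z), hz, hz⟩ hc1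
    exact ⟨q, hq.1, hq.2, fun x hx y hy => hqmax (a := (x, y)) ⟨hx, hy⟩⟩
  choose q hq1 hq2 hqmax using hmax
  have hzv : ∀ ε : ℝ, 0 < ε → ε < ρ → z + ε • v ∈ closure Ω := fun ε hε hερ =>
    subset_closure (hconez z hz (by simpa using hρ) ε hε hερ v (by simpa using hc))
  -- Comparing with the pair `(z + ε v, z)`, for which the penalty vanishes, bounds the penalty at
  -- the maximum.
  have hpen : ∀ ε : ℝ, 0 < ε → ε < ρ →
      ‖ε⁻¹ • ((q ε).1 - (q ε).2) - v‖ ^ 2 + ‖(q ε).2 - z‖ ^ 2 ≤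
        (T₁ (q ε).1 - T₁ (q ε).2) + (T₁ z - T₁ (z + ε • v)) := by
    intro ε hε hερ
    have h := hqmax ε (z + ε • v) (hzv ε hε hερ) z hz
    rw [add_sub_cancel_left, smul_smul, inv_mul_cancel₀ hε.ne', one_smul, sub_self, sub_self,
      norm_zero] at h
    have := hzmax' _ (hq2 ε)
    linarith
  have hsmall : ∀ᶠ ε : ℝ in 𝓝[>] 0, 0 < ε ∧ ε < ρ :=
    Ioo_mem_nhdsGT hρ
  have hid : Tendsto (fun ε : ℝ => ε) (𝓝[>] 0) (𝓝 0) :=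
    tendsto_nhdsWithin_of_tendsto_nhds tendsto_id
  have hqdiff : Tendsto (fun ε => (q ε).1 - (q ε).2) (𝓝[>] 0) (𝓝 0) := by
    rw [tendsto_zero_iff_norm_tendsto_zero]
    have hlim : Tendsto (fun ε : ℝ => ε * (4 * B + 1 + ‖v‖)) (𝓝[>] 0) (𝓝 0) := by
      simpa using hid.mul_const (4 * B + 1 + ‖v‖)
    refine squeeze_zero' (Eventually.of_forall fun _ => norm_nonneg _) ?_ hlim
    filter_upwards [hsmall] with ε hε
    have h := hpen ε hε.1 hε.2
    have e1 := abs_le.1 (hB _ (hq1 ε))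
    have e2 := abs_le.1 (hB _ (hq2 ε))
    have e3 := abs_le.1 (hB _ hz)
    have e4 := abs_le.1 (hB _ (hzv ε hε.1 hε.2))
    have h2 : ‖ε⁻¹ • ((q ε).1 - (q ε).2) - v‖ ≤ 4 * B + 1 := by
      nlinarith [sq_nonneg ‖(q ε).2 - z‖, norm_nonneg (ε⁻¹ • ((q ε).1 - (q ε).2) - v)]
    have h3 : (q ε).1 - (q ε).2 = ε • ((ε⁻¹ • ((q ε).1 - (q ε).2) - v) + v) := by
      rw [sub_add_cancel, smul_smul, mul_inv_cancel₀ hε.1.ne', one_smul]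
    calc ‖(q ε).1 - (q ε).2‖ = ε * ‖(ε⁻¹ • ((q ε).1 - (q ε).2) - v) + v‖ := by
          conv_lhs => rw [h3]
          rw [norm_smul, Real.norm_of_nonneg hε.1.le]
      _ ≤ ε * (‖ε⁻¹ • ((q ε).1 - (q ε).2) - v‖ + ‖v‖) :=
          mul_le_mul_of_nonneg_left (norm_add_le _ _) hε.1.le
      _ ≤ ε * (4 * B + 1 + ‖v‖) := mul_le_mul_of_nonneg_left (by linarith) hε.1.le
  have hT₁diff : Tendsto (fun ε => T₁ (q ε).1 - T₁ (q ε).2) (𝓝[>] 0) (𝓝 0) := by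
    have huc := Metric.uniformContinuousOn_iff.1
      (hK.uniformContinuousOn_of_continuous h₁.continuousOn)
    rw [Metric.tendsto_nhds]
    intro η hη
    obtain ⟨δ, hδ, hδη⟩ := huc η hη
    filter_upwards [Metric.tendsto_nhds.1 hqdiff δ hδ] with ε hε
    rw [dist_zero_right] at hε
    have := hδη _ (hq1 ε) _ (hq2 ε) (by rwa [dist_eq_norm])
    rwa [Real.dist_eq, sub_zero, ← Real.dist_eq]
  have hT₁z : Tendsto (fun ε : ℝ => T₁ z - T₁ (z + ε • v)) (𝓝[>] 0) (𝓝 0) := by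
    have hcv : Tendsto (fun ε : ℝ => z + ε • v) (𝓝[>] 0) (𝓝[closure Ω] z) := by
      refine tendsto_nhdsWithin_iff.2 ⟨?_, ?_⟩
      · simpa using tendsto_const_nhds.add (hid.smul_const v)
      · filter_upwards [hsmall] with ε hε using hzv ε hε.1 hε.2
    simpa using (tendsto_const_nhds (x := T₁ z)).sub ((h₁.continuousOn z hz).tendsto.comp hcv)
  have hsum : Tendsto (fun ε => ‖ε⁻¹ • ((q ε).1 - (q ε).2) - v‖ ^ 2 + ‖(q ε).2 - z‖ ^ 2)
      (𝓝[>] 0) (𝓝 0) := by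
    refine squeeze_zero' (Eventually.of_forall fun _ => by positivity) ?_
      (by simpa using hT₁diff.add hT₁z)
    filter_upwards [hsmall] with ε hε using hpen ε hε.1 hε.2
  have hsqrt : ∀ f : ℝ → ℝ, (∀ ε, 0 ≤ f ε) →
      (∀ ε, f ε ^ 2 ≤ ‖ε⁻¹ • ((q ε).1 - (q ε).2) - v‖ ^ 2 + ‖(q ε).2 - z‖ ^ 2) →
      Tendsto f (𝓝[>] 0) (𝓝 0) := by
    intro f hf0 hf
    have h := (squeeze_zero (fun ε => sq_nonneg (f ε)) hf hsum).sqrt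
    simpa [Real.sqrt_sq (hf0 _)] using h
  have hw : Tendsto (fun ε => ‖ε⁻¹ • ((q ε).1 - (q ε).2) - v‖) (𝓝[>] 0) (𝓝 0) :=
    hsqrt _ (fun _ => norm_nonneg _) fun _ => le_add_of_nonneg_right (sq_nonneg _)
  have hy : Tendsto (fun ε => ‖(q ε).2 - z‖) (𝓝[>] 0) (𝓝 0) :=
    hsqrt _ (fun _ => norm_nonneg _) fun _ => le_add_of_nonneg_left (sq_nonneg _)
  have hyz : Tendsto (fun ε => (q ε).2) (𝓝[>] 0) (𝓝 z) :=
    tendsto_iff_norm_sub_tendsto_zero.2 hy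
  have hxz : Tendsto (fun ε => (q ε).1) (𝓝[>] 0) (𝓝 z) := by
    simpa using hqdiff.add hyz
  have hs₁z := (hs₁ z hz).tendsto.comp
    (tendsto_nhdsWithin_iff.2 ⟨hxz, Eventually.of_forall hq1⟩)
  have hs₂z := (hs₂ z hz).tendsto.comp
    (tendsto_nhdsWithin_iff.2 ⟨hyz, Eventually.of_forall hq2⟩)
  have hlim : s₂ z ≤ s₁ z + 2 * 0 := by
    refine le_of_tendsto_of_tendsto hs₂z (hs₁z.add (hy.const_mul 2)) ?_
    filter_upwards [hsmall, hw.eventually_lt_const hc, hy.eventually_lt_const hρ,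
      hxz.eventually_ne hzx₀, hyz.eventually_ne hzx₀] with ε hε hεc hερ hxne hyne
    have hxΩ : (q ε).1 ∈ Ω := by
      have h := hconez (q ε).2 (hq2 ε) hερ ε hε.1 hε.2 (ε⁻¹ • ((q ε).1 - (q ε).2)) hεc
      rwa [smul_smul, mul_inv_cancel₀ hε.1.ne', one_smul, add_sub_cancel] at h
    obtain ⟨P, hP⟩ : ∃ P, P = (2 * ε⁻¹) • (ε⁻¹ • ((q ε).1 - (q ε).2) - v) := ⟨_, rfl⟩
    have hsub : ‖P‖ ≤ s₁ (q ε).1 := by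
      have hg := hasGradientAt_norm_sq_smul_sub ε⁻¹ (q ε).2 v (q ε).1
      have := h₁.subsolution (fun y => ‖ε⁻¹ • (y - (q ε).2) - v‖ ^ 2)
        (contDiff_norm_sq_smul_sub _ _ _) (q ε).1 ⟨hxΩ, hxne⟩ ?_
      · rwa [hg.gradient, ← hP] at this
      · filter_upwards [hopen.mem_nhds hxΩ] with y hyΩ
        have := hqmax ε y (subset_closure hyΩ) (q ε).2 (hq2 ε)
        linarith
    have hsup : s₂ (q ε).2 ≤ ‖P - (2 : ℝ) • ((q ε).2 - z)‖ := by
      have hg1 := hasGradientAt_norm_sq_smul_sub (-ε⁻¹) (q ε).1 v (q ε).2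
      have hg2 := hasGradientAt_norm_sq_smul_sub 1 z 0 (q ε).2
      have hg := hasGradientAt_neg (hasGradientAt_add hg1 hg2)
      have := h₂.supersolution
        (fun y => -(‖(-ε⁻¹) • (y - (q ε).1) - v‖ ^ 2 + ‖(1 : ℝ) • (y - z) - 0‖ ^ 2))
        ((contDiff_norm_sq_smul_sub _ _ _).add (contDiff_norm_sq_smul_sub _ _ _)).neg
        (q ε).2 ⟨hq2 ε, hyne⟩ ?_
      · rw [hg.gradient] at this
        refine this.trans_eq (congrArg _ ?_)
        rw [hP]; module
      · refine IsMinOn.localize fun y hyΩ => ?_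
        have := hqmax ε (q ε).1 (hq1 ε) y hyΩ
        have hr : ∀ y, (-ε⁻¹) • (y - (q ε).1) = ε⁻¹ • ((q ε).1 - y) := fun y => by module
        simp only [Set.mem_ofPred_eq, hr, one_smul, sub_zero]
        linarith
    calc s₂ (q ε).2 ≤ ‖P - (2 : ℝ) • ((q ε).2 - z)‖ := hsup
      _ ≤ ‖P‖ + ‖(2 : ℝ) • ((q ε).2 - z)‖ := norm_sub_le _ _
      _ ≤ s₁ (q ε).1 + 2 * ‖(q ε).2 - z‖ := by
        rw [norm_smul, Real.norm_two]; linarith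
  have := hlt z hz
  linarith

theorem IsEikonalSolution.const_mul {x₀ : EuclideanSpace ℝ (Fin d)}
    {s T : EuclideanSpace ℝ (Fin d) → ℝ} (h : IsEikonalSolution Ω x₀ s T) {a : ℝ} (ha : 0 < a) :
    IsEikonalSolution Ω x₀ (fun x => a * s x) (fun x => a * T x) := by
  have hgrad : ∀ φ : EuclideanSpace ℝ (Fin d) → ℝ, ContDiff ℝ 1 φ → ∀ x,
      a * ‖gradient (fun y => a⁻¹ * φ y) x‖ = ‖gradient φ x‖ := by
    intro φ hφ x
    have hd : DifferentiableAt ℝ φ x := hφ.differentiable (by norm_num) x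
    rw [norm_gradient, norm_gradient, fderiv_const_mul hd, norm_smul, Real.norm_of_nonneg
      (inv_nonneg.2 ha.le), ← mul_assoc, mul_inv_cancel₀ ha.ne', one_mul]
  refine ⟨continuousOn_const.mul h.continuousOn, by simp [h.source], ?_, ?_⟩
  · intro φ hφ x hx hmax
    rw [← hgrad φ hφ]
    refine mul_le_mul_of_nonneg_left
      (h.subsolution (fun y => a⁻¹ * φ y) (contDiff_const.mul hφ) x hx ?_) ha.le
    filter_upwards [hmax] with y hy
    have := mul_le_mul_of_nonneg_left hy (inv_nonneg.2 ha.le)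
    field_simp at this ⊢
    linarith
  · intro φ hφ x hx hmin
    rw [← hgrad φ hφ]
    refine mul_le_mul_of_nonneg_left
      (h.supersolution (fun y => a⁻¹ * φ y) (contDiff_const.mul hφ) x hx ?_) ha.le
    filter_upwards [hmin] with y hy
    have := mul_le_mul_of_nonneg_left hy (inv_nonneg.2 ha.le)
    field_simp at this ⊢
    linarith

/-- Comparison without a gap: scaling the smaller solution by `θ < 1` creates one. -/
theorem IsEikonalSolution.le_of_le (hcone : HasInteriorCones Ω) (hopen : IsOpen Ω)
    (hb : Bornology.IsBounded Ω) {x₀ : EuclideanSpace ℝ (Fin d)}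
    {s₁ s₂ T₁ T₂ : EuclideanSpace ℝ (Fin d) → ℝ}
    (hs₁ : ContinuousOn s₁ (closure Ω)) (hs₂ : ContinuousOn s₂ (closure Ω))
    (hpos : ∀ x ∈ closure Ω, 0 < s₁ x) (hle : ∀ x ∈ closure Ω, s₁ x ≤ s₂ x)
    (h₁ : IsEikonalSolution Ω x₀ s₁ T₁) (h₂ : IsEikonalSolution Ω x₀ s₂ T₂) :
    ∀ x ∈ closure Ω, T₁ x ≤ T₂ x := by
  intro x hx
  have hlim : Tendsto (fun θ : ℝ => θ * T₁ x) (𝓝[<] 1) (𝓝 (1 * T₁ x)) :=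
    (tendsto_nhdsWithin_of_tendsto_nhds tendsto_id).mul_const _
  rw [one_mul] at hlim
  refine le_of_tendsto hlim ?_
  filter_upwards [Ioo_mem_nhdsLT (zero_lt_one (α := ℝ))] with θ hθ
  refine IsEikonalSolution.le_of_lt hcone hopen hb (continuousOn_const.mul hs₁) hs₂
    (fun y hy => ?_) (h₁.const_mul hθ.1) h₂ x hx
  exact (mul_lt_of_lt_one_left (hpos y hy) hθ.2).trans_le (hle y hy)

/-! ### Existence by Perron's method -/

/-- The integrated form of the subsolution property: along each segment in `Ω`, `w` increases at
most at the rate of the slowness `s`. Unlike the viscosity form it passes to suprema at once. -/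
def IsSegmentSubsolution (Ω : Set (EuclideanSpace ℝ (Fin d)))
    (s w : EuclideanSpace ℝ (Fin d) → ℝ) : Prop :=
  ∀ x y, segment ℝ x y ⊆ Ω → ∀ M, (∀ z ∈ segment ℝ x y, s z ≤ M) → w x - w y ≤ M * ‖x - y‖

/-- The competitors in Perron's method. -/
def perronFamily (Ω : Set (EuclideanSpace ℝ (Fin d))) (x₀ : EuclideanSpace ℝ (Fin d))
    (s : EuclideanSpace ℝ (Fin d) → ℝ) : Set (EuclideanSpace ℝ (Fin d) → ℝ) :=
  {w | ContinuousOn w (closure Ω) ∧ w x₀ ≤ 0 ∧ IsSegmentSubsolution Ω s w}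

/-- The pointwise supremum of the competitors. It is finite on the closure of `Ω`, by
`bddAbove_perronFamily`; elsewhere its values carry no meaning. -/
noncomputable def perronSolution (Ω : Set (EuclideanSpace ℝ (Fin d)))
    (x₀ : EuclideanSpace ℝ (Fin d)) (s : EuclideanSpace ℝ (Fin d) → ℝ)
    (x : EuclideanSpace ℝ (Fin d)) : ℝ :=
  sSup ((fun w : EuclideanSpace ℝ (Fin d) → ℝ => w x) '' perronFamily Ω x₀ s)

/-- Competitors are locally Lipschitz up to the boundary, with common constants: two nearby points
of the closure are joined through `Ω` by moving both along the axis of the interior cone. -/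
theorem exists_lipschitz_perronFamily (hcone : HasInteriorCones Ω)
    {x₀ : EuclideanSpace ℝ (Fin d)} {s : EuclideanSpace ℝ (Fin d) → ℝ} {M : ℝ} (hM0 : 0 ≤ M)
    (hM : ∀ x ∈ closure Ω, s x ≤ M) {z : EuclideanSpace ℝ (Fin d)} (hz : z ∈ closure Ω) :
    ∃ C ρ : ℝ, 0 < ρ ∧ ∀ w ∈ perronFamily Ω x₀ s, ∀ x ∈ closure Ω, ∀ y ∈ closure Ω,
      ‖x - z‖ < ρ → ‖y - z‖ < ρ → w x ≤ w y + C * ‖x - y‖ := by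
  obtain ⟨v, c, ρ, hc, hρ, hconez⟩ := hcone z hz
  refine ⟨M * (4 / c * ‖v‖) + M, min ρ (ρ * c / 4), by positivity, ?_⟩
  rintro w ⟨hwc, -, hws⟩ x hx y hy hxz hyz
  rw [lt_min_iff] at hxz hyz
  rcases eq_or_ne x y with rfl | hxy
  · simp
  have hnorm : 0 < ‖x - y‖ := norm_sub_pos_iff.2 hxy
  set t : ℝ := 2 / c * ‖x - y‖ with ht
  have ht0 : 0 < t := by positivity
  have htρ : t < ρ := by
    have h1 : ‖x - y‖ < ρ * c / 2 := by
      calc ‖x - y‖ = ‖(x - z) - (y - z)‖ := by congr 1; abel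
        _ ≤ ‖x - z‖ + ‖y - z‖ := norm_sub_le _ _
        _ < ρ * c / 2 := by linarith
    rw [ht, div_mul_eq_mul_div, div_lt_iff₀ hc]; linarith
  have hmem : ∀ a ∈ closure Ω, ‖a - z‖ < ρ → ∀ τ, 0 < τ → τ < ρ → a + τ • v ∈ Ω :=
    fun a ha haz τ hτ hτρ => hconez a ha haz τ hτ hτρ v (by simpa using hc)
  have hseg : ∀ a b, segment ℝ a b ⊆ Ω → w a - w b ≤ M * ‖a - b‖ := fun a b hab =>
    hws a b hab M fun q hq => hM q (subset_closure (hab hq))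
  -- The estimate along the axis; the segment is started at `a + τ • v`, because `a` itself may lie
  -- on the boundary.
  have hvert : ∀ a ∈ closure Ω, ‖a - z‖ < ρ → |w a - w (a + t • v)| ≤ M * (t * ‖v‖) := by
    intro a ha haz
    have hlim : Tendsto (fun τ : ℝ => a + τ • v) (𝓝[>] 0) (𝓝[closure Ω] a) := by
      refine tendsto_nhdsWithin_iff.2 ⟨?_, ?_⟩
      · have : Tendsto (fun τ : ℝ => a + τ • v) (𝓝 0) (𝓝 (a + (0 : ℝ) • v)) :=
          (by fun_prop : Continuous fun τ : ℝ => a + τ • v).tendsto 0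
        rw [zero_smul, add_zero] at this
        exact tendsto_nhdsWithin_of_tendsto_nhds this
      · filter_upwards [Ioo_mem_nhdsGT hρ] with τ hτ
        exact subset_closure (hmem a ha haz τ hτ.1 hτ.2)
    have hlim' := (((hwc a ha).tendsto.comp hlim).sub_const (w (a + t • v))).abs
    refine le_of_tendsto hlim' ?_
    filter_upwards [Ioo_mem_nhdsGT ht0] with τ hτ
    have hsub : segment ℝ (a + τ • v) (a + t • v) ⊆ Ω := by
      rintro q ⟨α, β, hα, hβ, hαβ, rfl⟩
      have e : α • (a + τ • v) + β • (a + t • v) = a + (α * τ + β * t) • v := by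
        calc _ = (α + β) • a + (α * τ + β * t) • v := by module
          _ = _ := by rw [hαβ, one_smul]
      rw [e]
      have hα1 : α = 1 - β := by linarith
      refine hmem a ha haz _ ?_ ?_
      · subst hα1; nlinarith [hτ.1, hτ.2]
      · subst hα1; nlinarith [hτ.1, hτ.2]
    have hn : ‖(a + τ • v) - (a + t • v)‖ ≤ t * ‖v‖ := by
      have e : (a + τ • v) - (a + t • v) = (τ - t) • v := by module
      rw [e, norm_smul, Real.norm_eq_abs, abs_of_neg (by linarith [hτ.2])]
      exact mul_le_mul_of_nonneg_right (by linarith [hτ.1]) (norm_nonneg _)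
    have h1 := hseg _ _ hsub
    have h2 := hseg (a + t • v) (a + τ • v) (by rwa [segment_symm])
    rw [norm_sub_rev] at h2
    have h3 := mul_le_mul_of_nonneg_left hn hM0
    rw [Function.comp_apply]
    exact abs_le.2 ⟨by linarith, by linarith⟩
  -- The translated segment lies in `Ω` because `t` is large enough compared with `‖x - y‖`.
  have hhor : w (x + t • v) - w (y + t • v) ≤ M * ‖x - y‖ := by
    have hsub : segment ℝ (x + t • v) (y + t • v) ⊆ Ω := by
      rintro q ⟨α, β, hα, hβ, hαβ, rfl⟩
      have hα1 : α = 1 - β := by linarith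
      have e : α • (x + t • v) + β • (y + t • v) = x + t • (v + (β / t) • (y - x)) := by
        have htβ : t * (β / t) = β := by field_simp
        rw [smul_add t v, smul_smul t, htβ, hα1]
        module
      rw [e]
      refine hconez x hx hxz.1 t ht0 htρ _ ?_
      rw [add_sub_cancel_left, norm_smul, Real.norm_of_nonneg (by positivity), norm_sub_rev]
      calc β / t * ‖x - y‖ ≤ 1 / t * ‖x - y‖ := by gcongr; linarith
        _ = c / 2 := by rw [ht]; field_simp
        _ < c := by linarith
    have h := hseg _ _ hsub
    rwa [add_sub_add_right_eq_sub] at h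
  have hx' := (abs_le.1 (hvert x hx hxz.1)).2
  have hy' := (abs_le.1 (hvert y hy hyz.1)).1
  have hts : M * (t * ‖v‖) = M * (2 / c * ‖v‖) * ‖x - y‖ := by rw [ht]; ring
  have hfin : (M * (4 / c * ‖v‖) + M) * ‖x - y‖
      = 2 * (M * (2 / c * ‖v‖) * ‖x - y‖) + M * ‖x - y‖ := by ring
  rw [hfin]
  linarith

/-- Along a connected domain the local Lipschitz bounds add up to a bound at each point. -/
theorem bddAbove_perronFamily (hcone : HasInteriorCones Ω) (hconn : IsConnected Ω)
    {x₀ : EuclideanSpace ℝ (Fin d)} (hx₀ : x₀ ∈ Ω) {s : EuclideanSpace ℝ (Fin d) → ℝ} {M : ℝ}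
    (hM0 : 0 ≤ M) (hM : ∀ x ∈ closure Ω, s x ≤ M) {x : EuclideanSpace ℝ (Fin d)}
    (hx : x ∈ closure Ω) :
    BddAbove ((fun w : EuclideanSpace ℝ (Fin d) → ℝ => w x) '' perronFamily Ω x₀ s) := by
  have key := hconn.closure.isPreconnected.induction₂
    (fun x y => ∃ B : ℝ, ∀ w ∈ perronFamily Ω x₀ s, |w x - w y| ≤ B) ?_ ?_ ?_ hx
    (subset_closure hx₀)
  · obtain ⟨B, hB⟩ := key
    refine ⟨B, ?_⟩
    rintro _ ⟨w, hw, rfl⟩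
    have := (abs_le.1 (hB w hw)).2
    have := hw.2.1
    change w x ≤ B
    linarith
  · intro z hz
    obtain ⟨C, ρ, hρ, h⟩ := exists_lipschitz_perronFamily (x₀ := x₀) hcone hM0 hM hz
    filter_upwards [self_mem_nhdsWithin, nhdsWithin_le_nhds (Metric.ball_mem_nhds z hρ)]
      with y hy hyz
    rw [Metric.mem_ball, dist_eq_norm] at hyz
    have hzz : ‖z - z‖ < ρ := by simpa using hρ
    refine ⟨C * ‖z - y‖, fun w hw => abs_le.2 ⟨?_, ?_⟩⟩
    · have := h w hw y hy z hz hyz hzz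
      rw [norm_sub_rev] at this
      linarith
    · have := h w hw z hz y hy hzz hyz
      linarith
  · rintro a b e - - - ⟨B, hB⟩ ⟨B', hB'⟩
    exact ⟨B + B', fun w hw => (abs_sub_le _ (w b) _).trans (add_le_add (hB w hw) (hB' w hw))⟩
  · rintro a b - - ⟨B, hB⟩
    exact ⟨B, fun w hw => by rw [abs_sub_comm]; exact hB w hw⟩

/-- The integrated subsolution property implies the viscosity one: test it on short segments in the
direction opposite to the gradient of the test function. -/
theorem IsSegmentSubsolution.norm_gradient_le (hopen : IsOpen Ω)
    {s w φ : EuclideanSpace ℝ (Fin d) → ℝ} (hs : ContinuousOn s (closure Ω))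
    (hw : IsSegmentSubsolution Ω s w) (hφ : ContDiff ℝ 1 φ) {x : EuclideanSpace ℝ (Fin d)}
    (hx : x ∈ Ω) (hsx0 : 0 ≤ s x) (hmax : IsLocalMax (fun y => w y - φ y) x) :
    ‖gradient φ x‖ ≤ s x := by
  by_contra! hlt
  obtain ⟨M, hsM, hMg⟩ := exists_between hlt
  have hsx : ContinuousAt s x :=
    (hs x (subset_closure hx)).continuousAt (mem_of_superset (hopen.mem_nhds hx) subset_closure)
  obtain ⟨r, hr, hball⟩ := Metric.eventually_nhds_iff_ball.1
    ((hopen.eventually_mem hx).and ((hsx.eventually_lt_const hsM).and hmax))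
  set p := gradient φ x with hp
  have hgrad : HasGradientAt φ p x := (hφ.differentiable (by norm_num) x).hasGradientAt
  have hline : HasDerivAt (fun h : ℝ => x + h • (-p)) (-p) 0 := by
    simpa using ((hasDerivAt_id (0 : ℝ)).smul_const (-p)).const_add x
  have hderiv : HasDerivAt (fun h : ℝ => φ (x + h • (-p))) (-‖p‖ ^ 2) 0 := by
    have hgrad' : HasFDerivAt φ (InnerProductSpace.toDual ℝ _ p) (x + (0 : ℝ) • (-p)) := by
      rw [zero_smul, add_zero]; exact hgrad.hasFDerivAt
    refine (hgrad'.comp_hasDerivAt (0 : ℝ) hline).congr_deriv ?_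
    simp [inner_neg_right]
  have hslope := hderiv.tendsto_slope_zero_right
  have hlim : -(M * ‖p‖) ≤ -‖p‖ ^ 2 := by
    refine ge_of_tendsto hslope ?_
    have hnear : ∀ᶠ h : ℝ in 𝓝[>] 0, x + h • (-p) ∈ Metric.ball x r := by
      have : Tendsto (fun h : ℝ => x + h • (-p)) (𝓝 0) (𝓝 x) := by
        simpa using hline.continuousAt.tendsto
      exact (tendsto_nhdsWithin_of_tendsto_nhds this).eventually_mem (Metric.ball_mem_nhds x hr)
    filter_upwards [hnear, self_mem_nhdsWithin] with h hh h0
    have h0' : 0 < h := h0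
    have hsub : segment ℝ x (x + h • (-p)) ⊆ Metric.ball x r :=
      (convex_ball x r).segment_subset (Metric.mem_ball_self hr) hh
    have h1 := hw x (x + h • (-p)) (fun q hq => (hball q (hsub hq)).1) M
      fun q hq => (hball q (hsub hq)).2.1.le
    have h2 := (hball _ hh).2.2
    have h3 : ‖x - (x + h • (-p))‖ = h * ‖p‖ := by
      rw [sub_add_cancel_left, norm_neg, norm_smul, norm_neg, Real.norm_of_nonneg h0'.le]
    rw [h3] at h1
    simp only [zero_add, zero_smul, add_zero, smul_eq_mul]
    rw [inv_mul_eq_div, le_div_iff₀ h0']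
    linarith
  have hp0 : 0 < ‖p‖ := hsx0.trans_lt hlt
  nlinarith

open scoped Classical in
/-- Perron's bump: `T` is raised to `max T ψ` on a small ball. The hypothesis `ψ ≤ T` on the outer
half of the ball makes the two pieces fit together. -/
theorem IsSegmentSubsolution.bump {s T ψ : EuclideanSpace ℝ (Fin d) → ℝ}
    (hT : IsSegmentSubsolution Ω s T) (hψ : Differentiable ℝ ψ) {x : EuclideanSpace ℝ (Fin d)}
    {r : ℝ} (hr : 0 < r)
    (hgrad : ∀ y ∈ Ω, y ∈ Metric.ball x r → ‖fderiv ℝ ψ y‖ ≤ s y)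
    (hle : ∀ y ∈ Ω, y ∈ Metric.ball x r → r / 2 ≤ ‖y - x‖ → ψ y ≤ T y) :
    IsSegmentSubsolution Ω s
      ((Metric.ball x r).piecewise (fun y => max (T y) (ψ y)) T) := by
  intro a b hab M hM
  set w := (Metric.ball x r).piecewise (fun y => max (T y) (ψ y)) T with hw
  have haΩ : a ∈ Ω := hab (left_mem_segment ℝ a b)
  have hTw : T b ≤ w b := by
    by_cases hb : b ∈ Metric.ball x r
    · rw [hw, Set.piecewise_eq_of_mem _ _ _ hb]; exact le_max_left _ _
    · rw [hw, Set.piecewise_eq_of_notMem _ _ _ hb]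
  -- The mean value inequality for `ψ` on initial pieces of the segment inside the ball.
  have hmean : ∀ b' ∈ segment ℝ a b, a ∈ Metric.ball x r → b' ∈ Metric.ball x r →
      ψ a - ψ b' ≤ M * ‖a - b'‖ := by
    intro b' hb' ha hb'r
    have hsub : segment ℝ a b' ⊆ segment ℝ a b :=
      (convex_segment a b).segment_subset (left_mem_segment ℝ a b) hb'
    have hsubr : segment ℝ a b' ⊆ Metric.ball x r := (convex_ball x r).segment_subset ha hb'r
    refine (le_abs_self _).trans ?_
    exact (convex_segment a b').norm_image_sub_le_of_norm_fderiv_le (fun q _ => hψ q)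
      (fun q hq => (hgrad q (hab (hsub hq)) (hsubr hq)).trans (hM q (hsub hq)))
      (right_mem_segment ℝ a b') (left_mem_segment ℝ a b')
  by_cases haT : w a ≤ T a
  · have := hT a b hab M hM
    linarith
  have ha : a ∈ Metric.ball x r := by
    by_contra ha
    exact haT (by rw [hw, Set.piecewise_eq_of_notMem _ _ _ ha])
  have hwa : w a = ψ a := by
    rw [hw, Set.piecewise_eq_of_mem _ _ _ ha] at haT ⊢
    rcases max_choice (T a) (ψ a) with h | h
    · exact absurd h.le haT
    · exact h
  by_cases hb : b ∈ Metric.ball x r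
  · have hψb : ψ b ≤ w b := by
      rw [hw, Set.piecewise_eq_of_mem _ _ _ hb]; exact le_max_right _ _
    have := hmean b (right_mem_segment ℝ a b) ha hb
    linarith
  -- The segment leaves the ball: it meets the sphere of radius `r / 2`, where `ψ ≤ T`.
  have har : ‖a - x‖ ≤ r / 2 := by
    by_contra! h
    exact haT (by rw [hwa]; exact hle a haΩ ha h.le)
  have hbr : r / 2 ≤ ‖b - x‖ := by
    rw [Metric.mem_ball, dist_eq_norm, not_lt] at hb; linarith
  obtain ⟨y, hy, hyr⟩ : ∃ y ∈ segment ℝ a b, ‖y - x‖ = r / 2 :=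
    (convex_segment a b).isPreconnected.intermediate_value (left_mem_segment ℝ a b)
      (right_mem_segment ℝ a b) (f := fun y => ‖y - x‖) (by fun_prop) ⟨har, hbr⟩
  have hyball : y ∈ Metric.ball x r := by
    rw [Metric.mem_ball, dist_eq_norm, hyr]; linarith
  have hsub : segment ℝ y b ⊆ segment ℝ a b :=
    (convex_segment a b).segment_subset hy (right_mem_segment ℝ a b)
  have h1 := hmean y hy ha hyball
  have h2 := hle y (hab hy) hyball hyr.ge
  have h3 := hT y b (hsub.trans hab) M fun q hq => hM q (hsub hq)
  have h4 := dist_add_dist_of_mem_segment hy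
  rw [dist_eq_norm, dist_eq_norm, dist_eq_norm] at h4
  rw [← h4, mul_add]
  linarith

open scoped Classical in
/-- The supremum of all competitors solves the Soner boundary value problem. -/
theorem isEikonalSolution_perronSolution (hcone : HasInteriorCones Ω) (hopen : IsOpen Ω)
    (hconn : IsConnected Ω) (hb : Bornology.IsBounded Ω) {x₀ : EuclideanSpace ℝ (Fin d)}
    (hx₀ : x₀ ∈ Ω) {s : EuclideanSpace ℝ (Fin d) → ℝ} (hs : ContinuousOn s (closure Ω))
    (hpos : ∀ x ∈ closure Ω, 0 ≤ s x) :
    IsEikonalSolution Ω x₀ s (perronSolution Ω x₀ s) := by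
  obtain ⟨M, hM⟩ : ∃ M, ∀ x ∈ closure Ω, s x ≤ M := by
    obtain ⟨B, hB⟩ := (hb.isCompact_closure.image_of_continuousOn hs).isBounded.exists_norm_le
    exact ⟨B, fun x hx => (le_abs_self _).trans (hB _ ⟨x, hx, rfl⟩)⟩
  have hM0 : 0 ≤ M := (hpos _ (subset_closure hx₀)).trans (hM _ (subset_closure hx₀))
  set T := perronSolution Ω x₀ s with hTdef
  have hzero : (fun _ => 0) ∈ perronFamily Ω x₀ s := by
    refine ⟨continuousOn_const, le_rfl, fun x y hxy M' hM' => ?_⟩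
    rw [sub_zero]
    have hxx := left_mem_segment ℝ x y
    exact mul_nonneg ((hpos x (subset_closure (hxy hxx))).trans (hM' x hxx)) (norm_nonneg _)
  have hle : ∀ w ∈ perronFamily Ω x₀ s, ∀ x ∈ closure Ω, w x ≤ T x := fun w hw x hx =>
    le_csSup (bddAbove_perronFamily hcone hconn hx₀ hM0 hM hx) ⟨w, hw, rfl⟩
  have hsup : ∀ x B, (∀ w ∈ perronFamily Ω x₀ s, w x ≤ B) → T x ≤ B := by
    intro x B hB
    refine csSup_le ⟨_, _, hzero, rfl⟩ ?_
    rintro _ ⟨w, hw, rfl⟩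
    exact hB w hw
  have hsource : T x₀ = 0 :=
    le_antisymm (hsup _ _ fun w hw => hw.2.1) (hle _ hzero x₀ (subset_closure hx₀))
  have hcont : ContinuousOn T (closure Ω) := by
    intro z hz
    obtain ⟨C, ρ, hρ, hC⟩ := exists_lipschitz_perronFamily (x₀ := x₀) hcone hM0 hM hz
    have hlim : Tendsto (fun y => C * ‖y - z‖) (𝓝[closure Ω] z) (𝓝 0) := by
      have : Continuous fun y : EuclideanSpace ℝ (Fin d) => C * ‖y - z‖ := by fun_prop
      simpa using (this.tendsto z).mono_left nhdsWithin_le_nhds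
    refine tendsto_iff_dist_tendsto_zero.2 (squeeze_zero' (Eventually.of_forall fun _ =>
      dist_nonneg) ?_ hlim)
    filter_upwards [self_mem_nhdsWithin, nhdsWithin_le_nhds (Metric.ball_mem_nhds z hρ)]
      with y hy hyz
    rw [Metric.mem_ball, dist_eq_norm] at hyz
    have hzz : ‖z - z‖ < ρ := by simpa using hρ
    have h1 : T y ≤ T z + C * ‖y - z‖ := hsup _ _ fun w hw =>
      (hC w hw y hy z hz hyz hzz).trans (by linarith [hle w hw z hz])
    have h2 : T z ≤ T y + C * ‖y - z‖ := hsup _ _ fun w hw => by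
      have := hC w hw z hz y hy hzz hyz
      rw [norm_sub_rev] at this
      linarith [hle w hw y hy]
    rw [Real.dist_eq]
    exact abs_le.2 ⟨by linarith, by linarith⟩
  have hseg : IsSegmentSubsolution Ω s T := by
    intro x y hxy M' hM'
    have hy : y ∈ closure Ω := subset_closure (hxy (right_mem_segment ℝ x y))
    have : T x ≤ T y + M' * ‖x - y‖ := hsup _ _ fun w hw => by
      linarith [hw.2.2 x y hxy M' hM', hle w hw y hy]
    linarith
  refine ⟨hcont, hsource, fun φ hφ x hx hmax => hseg.norm_gradient_le hopen hs hφ hx.1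
    (hpos x (subset_closure hx.1)) hmax, ?_⟩
  intro φ hφ x hx hmin
  by_contra! hlt
  have hxcl : x ∈ closure Ω := hx.1
  -- With `r ^ 2 / 4` added below, the bump exceeds `T` at `x` but not at distance `r / 2` or more:
  -- subtracting `‖y - x‖ ^ 2` makes the contact at `x` quadratically strict.
  have hχ : ∀ k : ℝ, ContDiff ℝ 1 fun y => φ y - ‖y - x‖ ^ 2 + k := fun k =>
    (hφ.sub (ContDiff.norm_sq ℝ (by fun_prop))).add contDiff_const
  have hχx : ∀ k : ℝ, fderiv ℝ (fun y => φ y - ‖y - x‖ ^ 2 + k) x = fderiv ℝ φ x := by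
    intro k
    have h1 : HasFDerivAt (fun y => ‖y - x‖ ^ 2) (0 : EuclideanSpace ℝ (Fin d) →L[ℝ] ℝ) x := by
      simpa using ((hasFDerivAt_id x).sub_const x).norm_sq
    have h2 := ((hφ.differentiable (by norm_num) x).hasFDerivAt.sub h1).add_const k
    rw [sub_zero] at h2
    exact h2.fderiv
  have hnear : ∀ᶠ y in 𝓝[closure Ω] x,
      ‖fderiv ℝ (fun y => φ y - ‖y - x‖ ^ 2 + 0) y‖ < s y ∧
        T x - φ x ≤ T y - φ y ∧ y ≠ x₀ := by
    have hc : Continuous fun y => ‖fderiv ℝ (fun y => φ y - ‖y - x‖ ^ 2 + 0) y‖ :=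
      ((hχ 0).continuous_fderiv (by norm_num)).norm
    have hc' := (hc.tendsto x).mono_left (nhdsWithin_le_nhds (s := closure Ω))
    refine (hc'.eventually_lt (hs x hxcl) ?_).and (hmin.and ?_)
    · rw [hχx, ← norm_gradient]; exact hlt
    · exact nhdsWithin_le_nhds (isOpen_ne.mem_nhds hx.2)
  obtain ⟨r, hr, hball⟩ := Metric.mem_nhdsWithin_iff.1 hnear
  set k : ℝ := T x - φ x + r ^ 2 / 4 with hk
  set χ : EuclideanSpace ℝ (Fin d) → ℝ := fun y => φ y - ‖y - x‖ ^ 2 + k with hχdef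
  have hfd : ∀ y, fderiv ℝ χ y = fderiv ℝ (fun y => φ y - ‖y - x‖ ^ 2 + 0) y := by
    intro y
    rw [hχdef, fderiv_add_const, fderiv_add_const]
  have hann : ∀ y ∈ closure Ω, y ∈ Metric.ball x r → r / 2 ≤ ‖y - x‖ → χ y ≤ T y := by
    intro y hy hyr hyx
    have h1 : T x - φ x ≤ T y - φ y := (hball ⟨hyr, hy⟩).2.1
    have h2 : r ^ 2 / 4 ≤ ‖y - x‖ ^ 2 := by nlinarith
    change φ y - ‖y - x‖ ^ 2 + (T x - φ x + r ^ 2 / 4) ≤ T y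
    linarith
  have hbump := hseg.bump ((hχ k).differentiable (by norm_num)) hr
    (fun y hy hyr => by
      rw [hfd]; exact (hball ⟨hyr, subset_closure hy⟩).1.le)
    (fun y hy hyr hyx => hann y (subset_closure hy) hyr hyx)
  set w := (Metric.ball x r).piecewise (fun y => max (T y) (χ y)) T with hw
  have hwF : w ∈ perronFamily Ω x₀ s := by
    refine ⟨?_, ?_, hbump⟩
    · intro y hy
      by_cases hyr : y ∈ Metric.ball x r
      · refine ContinuousWithinAt.congr_of_eventuallyEq
          ((hcont y hy).max ((hχ k).continuous.continuousWithinAt)) ?_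
          (Set.piecewise_eq_of_mem _ _ _ hyr)
        filter_upwards [nhdsWithin_le_nhds (Metric.isOpen_ball.mem_nhds hyr)] with q hq
        exact Set.piecewise_eq_of_mem _ _ _ hq
      · have hyx : r / 2 < ‖y - x‖ := by
          rw [Metric.mem_ball, dist_eq_norm, not_lt] at hyr; linarith
        refine (hcont y hy).congr_of_eventuallyEq ?_ (Set.piecewise_eq_of_notMem _ _ _ hyr)
        have hop : IsOpen {q : EuclideanSpace ℝ (Fin d) | r / 2 < ‖q - x‖} :=
          isOpen_lt continuous_const (by fun_prop)
        filter_upwards [self_mem_nhdsWithin, nhdsWithin_le_nhds (hop.mem_nhds hyx)] with q hq hqx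
        by_cases hqr : q ∈ Metric.ball x r
        · rw [hw, Set.piecewise_eq_of_mem _ _ _ hqr]
          exact max_eq_left (hann q hq hqr (le_of_lt hqx))
        · rw [hw, Set.piecewise_eq_of_notMem _ _ _ hqr]
    · have : x₀ ∉ Metric.ball x r := fun h => (hball ⟨h, subset_closure hx₀⟩).2.2 rfl
      rw [hw, Set.piecewise_eq_of_notMem _ _ _ this, hsource]
  have h1 := hle w hwF x hxcl
  rw [hw, Set.piecewise_eq_of_mem _ _ _ (Metric.mem_ball_self hr)] at h1
  have h2 : χ x = T x + r ^ 2 / 4 := by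
    change φ x - ‖x - x‖ ^ 2 + (T x - φ x + r ^ 2 / 4) = _
    rw [sub_self, norm_zero]; ring
  have h3 := (le_max_right (T x) (χ x)).trans h1
  have : 0 < r ^ 2 := by positivity
  linarith

/-! ### The slowness as a function of the parameter -/

theorem le_on_closure_of_ae_le (hopen : IsOpen Ω) {f g : EuclideanSpace ℝ (Fin d) → ℝ}
    (hf : ContinuousOn f (closure Ω)) (hg : ContinuousOn g (closure Ω))
    (h : ∀ᵐ y ∂(volume.restrict Ω), f y ≤ g y) : ∀ y ∈ closure Ω, f y ≤ g y := by
  have hm : ContinuousOn (fun y => max (f y) (g y)) (closure Ω) := hf.sup hg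
  have hae : (fun y => max (f y) (g y)) =ᵐ[volume.restrict Ω] g := by
    filter_upwards [h] with y hy using max_eq_right hy
  have hEq : Set.EqOn (fun y => max (f y) (g y)) g Ω :=
    Measure.eqOn_open_of_ae_eq hae hopen (hm.mono subset_closure) (hg.mono subset_closure)
  intro y hy
  have := hEq.of_subset_closure hm hg subset_closure subset_rfl hy
  exact max_eq_right_iff.1 this

theorem supNorm_nonneg (f : EuclideanSpace ℝ (Fin d) → ℝ) : 0 ≤ supNorm Ω f :=
  ENNReal.toReal_nonneg

theorem ae_abs_le_supNorm {f : EuclideanSpace ℝ (Fin d) → ℝ}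
    (hf : MemLp f ∞ (volume.restrict Ω)) :
    ∀ᵐ y ∂(volume.restrict Ω), |f y| ≤ supNorm Ω f := by
  filter_upwards [ae_le_eLpNormEssSup (f := f) (μ := volume.restrict Ω)] with y hy
  rw [← eLpNorm_exponent_top] at hy
  have := ENNReal.toReal_mono hf.eLpNorm_ne_top hy
  simpa [supNorm] using this

variable {ψ : ℕ → EuclideanSpace ℝ (Fin d) → ℝ}

/-- The distance of the parameters `u` and `u'` in the weighted `ℓ¹` norm that defines `U`. -/
noncomputable def paramDist (Ω : Set (EuclideanSpace ℝ (Fin d)))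
    (ψ : ℕ → EuclideanSpace ℝ (Fin d) → ℝ) (u u' : ℕ → ℝ) : ℝ :=
  ∑' i, |u i - u' i| * supNorm Ω (ψ i)

theorem paramDist_comm (u u' : ℕ → ℝ) : paramDist Ω ψ u u' = paramDist Ω ψ u' u := by
  simp only [paramDist, abs_sub_comm]

theorem summable_mul_of_mem_paramSpace {u : ℕ → ℝ} (hu : u ∈ paramSpace Ω ψ)
    {y : EuclideanSpace ℝ (Fin d)} (hy : ∀ i, |ψ i y| ≤ supNorm Ω (ψ i)) :
    Summable fun i => u i * ψ i y := by
  refine Summable.of_norm_bounded (g := fun i => |u i| * supNorm Ω (ψ i)) hu fun i => ?_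
  rw [norm_mul]
  exact mul_le_mul_of_nonneg_left (hy i) (abs_nonneg _)

theorem summable_paramDist {u u' : ℕ → ℝ} (hu : u ∈ paramSpace Ω ψ)
    (hu' : u' ∈ paramSpace Ω ψ) : Summable fun i => |u i - u' i| * supNorm Ω (ψ i) := by
  refine Summable.of_nonneg_of_le (fun i => mul_nonneg (abs_nonneg _) (supNorm_nonneg _))
    (fun i => ?_) (Summable.add hu hu')
  rw [← add_mul]
  exact mul_le_mul_of_nonneg_right (abs_sub _ _) (supNorm_nonneg _)

section Slowness

variable {sStar sBar : EuclideanSpace ℝ (Fin d) → ℝ}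
  {s : paramSpace Ω ψ → EuclideanSpace ℝ (Fin d) → ℝ}

theorem slowness_pos (hopen : IsOpen Ω)
    (hsStar_nonneg : ∀ᵐ y ∂(volume.restrict Ω), 0 ≤ sStar y)
    (hsBar : MemLp sBar ∞ (volume.restrict Ω))
    (hψ : ∀ i, MemLp (ψ i) ∞ (volume.restrict Ω))
    (hs_cont : ∀ u, ContinuousOn (s u) (closure Ω))
    (hs : ∀ u, ∀ᵐ y ∂(volume.restrict Ω),
      s u y = sStar y + Real.exp (sBar y + ∑' i, (u : ℕ → ℝ) i * ψ i y))
    (u : paramSpace Ω ψ) : ∀ y ∈ closure Ω, 0 < s u y := by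
  -- The lower bound `exp m` holds almost everywhere in `Ω`, hence everywhere by continuity.
  set m := -(supNorm Ω sBar + ∑' i, |(u : ℕ → ℝ) i| * supNorm Ω (ψ i)) with hm
  have h := le_on_closure_of_ae_le hopen (continuousOn_const (c := Real.exp m)) (hs_cont u) ?_
  · exact fun y hy => (Real.exp_pos m).trans_le (h y hy)
  filter_upwards [hsStar_nonneg, ae_abs_le_supNorm hsBar,
    ae_all_iff.2 fun i => ae_abs_le_supNorm (hψ i), hs u] with y h0 hB hall hsy
  have hsum : |∑' i, (u : ℕ → ℝ) i * ψ i y| ≤ ∑' i, |(u : ℕ → ℝ) i| * supNorm Ω (ψ i) := by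
    have hu : Summable fun i => |(u : ℕ → ℝ) i| * supNorm Ω (ψ i) := u.2
    refine tsum_of_norm_bounded (f := fun i => (u : ℕ → ℝ) i * ψ i y) hu.hasSum fun i => ?_
    rw [norm_mul]
    exact mul_le_mul_of_nonneg_left (hall i) (abs_nonneg _)
  have he : Real.exp m ≤ Real.exp (sBar y + ∑' i, (u : ℕ → ℝ) i * ψ i y) := by
    refine Real.exp_le_exp.2 ?_
    have := (abs_le.1 hB).1
    have := (abs_le.1 hsum).1
    linarith
  rw [hsy]
  linarith

/-- The logarithm of the slowness is Lipschitz in the parameter. -/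
theorem slowness_le (hopen : IsOpen Ω)
    (hsStar_nonneg : ∀ᵐ y ∂(volume.restrict Ω), 0 ≤ sStar y)
    (hψ : ∀ i, MemLp (ψ i) ∞ (volume.restrict Ω))
    (hs_cont : ∀ u, ContinuousOn (s u) (closure Ω))
    (hs : ∀ u, ∀ᵐ y ∂(volume.restrict Ω),
      s u y = sStar y + Real.exp (sBar y + ∑' i, (u : ℕ → ℝ) i * ψ i y))
    (u u' : paramSpace Ω ψ) :
    ∀ y ∈ closure Ω, s u y ≤ Real.exp (paramDist Ω ψ u u') * s u' y := by
  refine le_on_closure_of_ae_le hopen (hs_cont u) (continuousOn_const.mul (hs_cont u')) ?_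
  filter_upwards [hsStar_nonneg, ae_all_iff.2 fun i => ae_abs_le_supNorm (hψ i), hs u, hs u']
    with y h0 hall hsy hsy'
  have hsum := summable_mul_of_mem_paramSpace u.2 hall
  have hsum' := summable_mul_of_mem_paramSpace u'.2 hall
  have hdiff : (∑' i, (u : ℕ → ℝ) i * ψ i y) - ∑' i, (u' : ℕ → ℝ) i * ψ i y
      ≤ paramDist Ω ψ u u' := by
    rw [← hsum.tsum_sub hsum']
    refine (le_abs_self _).trans ?_
    refine tsum_of_norm_bounded (f := fun i => (u : ℕ → ℝ) i * ψ i y - (u' : ℕ → ℝ) i * ψ i y)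
      (summable_paramDist u.2 u'.2).hasSum fun i => ?_
    rw [← sub_mul, norm_mul]
    exact mul_le_mul_of_nonneg_left (hall i) (abs_nonneg _)
  have hd0 : 0 ≤ paramDist Ω ψ u u' :=
    tsum_nonneg fun i => mul_nonneg (abs_nonneg _) (supNorm_nonneg _)
  rw [hsy, hsy', mul_add, ← Real.exp_add]
  refine add_le_add (le_mul_of_one_le_left h0 (Real.one_le_exp hd0)) (Real.exp_le_exp.2 ?_)
  linarith

/-! ### Measurability of the forward map -/

/-- Travel times depend continuously on the parameter, by comparison with the rescaled solutions
`exp (± paramDist u u') * T u`. -/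
theorem tendsto_solution (hcone : HasInteriorCones Ω) (hopen : IsOpen Ω)
    (hb : Bornology.IsBounded Ω) {x₀ : EuclideanSpace ℝ (Fin d)}
    (hs_cont : ∀ u, ContinuousOn (s u) (closure Ω))
    (hpos : ∀ u, ∀ y ∈ closure Ω, 0 < s u y)
    (hle : ∀ u u' : paramSpace Ω ψ,
      ∀ y ∈ closure Ω, s u y ≤ Real.exp (paramDist Ω ψ u u') * s u' y)
    {T : paramSpace Ω ψ → EuclideanSpace ℝ (Fin d) → ℝ}
    (hT : ∀ u, IsEikonalSolution Ω x₀ (s u) (T u)) {ι : Type*} {l : Filter ι}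
    {v : ι → paramSpace Ω ψ} {u : paramSpace Ω ψ}
    (hv : Tendsto (fun n => paramDist Ω ψ (v n) u) l (𝓝 0)) {y : EuclideanSpace ℝ (Fin d)}
    (hy : y ∈ closure Ω) : Tendsto (fun n => T (v n) y) l (𝓝 (T u y)) := by
  have hcomp : ∀ u u' : paramSpace Ω ψ, T u y ≤ Real.exp (paramDist Ω ψ u u') * T u' y :=
    fun u u' => IsEikonalSolution.le_of_le hcone hopen hb (hs_cont u)
      (continuousOn_const.mul (hs_cont u')) (hpos u) (hle u u') (hT u)
      ((hT u').const_mul (Real.exp_pos _)) y hy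
  have hup : Tendsto (fun n => Real.exp (paramDist Ω ψ (v n) u) * T u y) l (𝓝 (T u y)) := by
    have := ((Real.continuous_exp.tendsto 0).comp hv).mul_const (T u y)
    rwa [Real.exp_zero, one_mul] at this
  have hlow : Tendsto (fun n => Real.exp (-paramDist Ω ψ (v n) u) * T u y) l (𝓝 (T u y)) := by
    have h0 : Tendsto (fun n => -paramDist Ω ψ (v n) u) l (𝓝 0) := by simpa using hv.neg
    have := ((Real.continuous_exp.tendsto 0).comp h0).mul_const (T u y)
    rwa [Real.exp_zero, one_mul] at this
  refine tendsto_of_tendsto_of_tendsto_of_le_of_le hlow hup (fun n => ?_) fun n => hcomp (v n) u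
  have h := hcomp u (v n)
  rw [paramDist_comm] at h
  calc Real.exp (-paramDist Ω ψ (v n) u) * T u y
      ≤ Real.exp (-paramDist Ω ψ (v n) u) * (Real.exp (paramDist Ω ψ (v n) u) * T (v n) y) :=
        mul_le_mul_of_nonneg_left h (Real.exp_pos _).le
    _ = T (v n) y := by rw [← mul_assoc, ← Real.exp_add, neg_add_cancel, Real.exp_zero, one_mul]

/-- The parameter with all but its first `n` coordinates replaced by zero. -/
noncomputable def truncate (n : ℕ) (u : paramSpace Ω ψ) : paramSpace Ω ψ :=
  ⟨fun i => if i < n then (u : ℕ → ℝ) i else 0, by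
    refine Summable.of_nonneg_of_le (fun i => mul_nonneg (abs_nonneg _) (supNorm_nonneg _))
      (fun i => ?_) u.2
    refine mul_le_mul_of_nonneg_right ?_ (supNorm_nonneg _)
    beta_reduce
    split_ifs
    · exact le_rfl
    · simp⟩

theorem tendsto_paramDist_truncate (u : paramSpace Ω ψ) :
    Tendsto (fun n => paramDist Ω ψ (truncate n u) u) atTop (𝓝 0) := by
  have hu : Summable fun i => |(u : ℕ → ℝ) i| * supNorm Ω (ψ i) := u.2
  have h := tendsto_tsum_of_dominated_convergence (𝓕 := atTop)
    (f := fun n i => |(truncate n u : ℕ → ℝ) i - (u : ℕ → ℝ) i| * supNorm Ω (ψ i))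
    (g := fun _ => (0 : ℝ)) hu (fun i => ?_) (Eventually.of_forall fun n i => ?_)
  · simpa [paramDist] using h
  · refine tendsto_const_nhds.congr' ?_
    filter_upwards [eventually_gt_atTop i] with n hn
    simp [truncate, hn]
  · rw [norm_mul, Real.norm_eq_abs, abs_abs, Real.norm_of_nonneg (supNorm_nonneg _)]
    refine mul_le_mul_of_nonneg_right ?_ (supNorm_nonneg _)
    by_cases hi : i < n <;> simp [truncate, hi]

/-- Only finitely many coordinates of a truncated parameter matter, so that coordinatewise
convergence suffices. -/
theorem tendsto_paramDist_truncate_nhds (n : ℕ) (u : paramSpace Ω ψ) :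
    Tendsto (fun u' : paramSpace Ω ψ => paramDist Ω ψ (truncate n u') (truncate n u))
      (𝓝 u) (𝓝 0) := by
  have h : ∀ u' : paramSpace Ω ψ, paramDist Ω ψ (truncate n u') (truncate n u) =
      ∑ i ∈ Finset.range n, |(u' : ℕ → ℝ) i - (u : ℕ → ℝ) i| * supNorm Ω (ψ i) := by
    intro u'
    rw [paramDist, tsum_eq_sum (s := Finset.range n)]
    · refine Finset.sum_congr rfl fun i hi => ?_
      simp [truncate, Finset.mem_range.1 hi]
    · intro i hi
      have hi' : ¬ i < n := fun h => hi (Finset.mem_range.2 h)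
      simp [truncate, hi']
  simp only [h]
  have hc : Continuous fun u' : paramSpace Ω ψ =>
      ∑ i ∈ Finset.range n, |(u' : ℕ → ℝ) i - (u : ℕ → ℝ) i| * supNorm Ω (ψ i) := by
    refine continuous_finsetSum _ fun i _ => ?_
    have : Continuous fun u' : paramSpace Ω ψ => (u' : ℕ → ℝ) i :=
      (continuous_apply i).comp continuous_subtype_val
    exact (this.sub continuous_const).abs.mul continuous_const
  simpa using hc.tendsto u

/-- The travel time is the pointwise limit of continuous functions of finitely many coordinates. -/
theorem measurable_solution {T : paramSpace Ω ψ → EuclideanSpace ℝ (Fin d) → ℝ}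
    {y : EuclideanSpace ℝ (Fin d)}
    (hT : ∀ (ι : Type) (l : Filter ι) (v : ι → paramSpace Ω ψ) (u : paramSpace Ω ψ),
      Tendsto (fun n => paramDist Ω ψ (v n) u) l (𝓝 0) →
        Tendsto (fun n => T (v n) y) l (𝓝 (T u y))) :
    Measurable fun u => T u y := by
  refine measurable_of_tendsto_metrizable (f := fun n u => T (truncate n u) y) (fun n => ?_)
    (tendsto_pi_nhds.2 fun u => hT _ _ _ u (tendsto_paramDist_truncate u))
  refine Continuous.measurable (continuous_iff_continuousAt.2 fun u => ?_)
  exact hT _ _ (fun u' => truncate n u') _ (tendsto_paramDist_truncate_nhds n u)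

end Slowness

/-! ### The prior is a probability measure -/

theorem isProbabilityMeasure_prior {c₀ p : ℝ} (hp : 1 < p)
    (hdecay : ∀ i : ℕ, supNorm Ω (ψ i) < c₀ * ((i : ℝ) + 1) ^ (-p)) :
    IsProbabilityMeasure (prior Ω ψ) := by
  have hsum : Summable fun i => supNorm Ω (ψ i) := by
    refine Summable.of_nonneg_of_le (fun i => supNorm_nonneg _) (fun i => (hdecay i).le) ?_
    refine Summable.mul_left _ ?_
    have h := (summable_nat_add_iff 1).2 (Real.summable_nat_rpow.2 (neg_lt_neg hp))
    simpa using h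
  refine (MeasurableEmbedding.subtype_coe
    (measurableSet_paramSpace Ω ψ)).isProbabilityMeasure_comap ?_
  set P := Measure.infinitePi fun _ : ℕ => gaussianReal 0 1 with hP
  -- The expectation of `∑ |uᵢ| bᵢ` is `C * ∑ bᵢ`, with `C` the first absolute moment of `𝒩(0, 1)`.
  set C : ℝ≥0∞ := ∫⁻ x, ‖x‖ₑ ∂(gaussianReal 0 1) with hC
  have hCtop : C ≠ ∞ := by
    have : Integrable id (gaussianReal 0 1) := IsGaussian.integrable_id
    exact this.2.ne
  have hmeas : ∀ i, Measurable fun u : ℕ → ℝ => ‖u i‖ₑ * ENNReal.ofReal (supNorm Ω (ψ i)) :=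
    fun i => ((measurable_pi_apply i).enorm).mul_const _
  have hint : ∫⁻ u, ∑' i, ‖u i‖ₑ * ENNReal.ofReal (supNorm Ω (ψ i)) ∂P ≠ ∞ := by
    rw [lintegral_tsum fun i => (hmeas i).aemeasurable]
    have heach : ∀ i, ∫⁻ u, ‖u i‖ₑ * ENNReal.ofReal (supNorm Ω (ψ i)) ∂P =
        C * ENNReal.ofReal (supNorm Ω (ψ i)) := by
      intro i
      rw [lintegral_mul_const _ ((measurable_pi_apply i).enorm), hC]
      congr 1
      exact (measurePreserving_eval_infinitePi (fun _ : ℕ => gaussianReal 0 1) i).lintegral_comp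
        measurable_enorm
    simp only [heach]
    rw [ENNReal.tsum_mul_left]
    exact ENNReal.mul_ne_top hCtop hsum.tsum_ofReal_ne_top
  filter_upwards [ae_lt_top (Measurable.tsum hmeas) hint] with u hu
  rw [Subtype.range_coe]
  have h := ENNReal.summable_toReal hu.ne
  refine h.congr fun i => ?_
  rw [ENNReal.toReal_mul, ENNReal.toReal_ofReal (supNorm_nonneg _), toReal_enorm,
    Real.norm_eq_abs]

/-! ### Gaussian noise -/

theorem covNorm_zero {N : ℕ} (S : Matrix (Fin N) (Fin N) ℝ) : covNorm S 0 = 0 := by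
  simp [covNorm]

open scoped MatrixOrder in
/-- The square root of the covariance matrix as a linear automorphism `L`. -/
theorem exists_equiv_covNorm {N : ℕ} {S : Matrix (Fin N) (Fin N) ℝ} (hS : S.PosDef) :
    ∃ L : EuclideanSpace ℝ (Fin N) ≃L[ℝ] EuclideanSpace ℝ (Fin N),
      (∀ v, covNorm S v = ‖L.symm v‖) ∧
        multivariateGaussian 0 S = (stdGaussian (EuclideanSpace ℝ (Fin N))).map L := by
  set R := CFC.sqrt S with hR
  have hRR : R * R = S := CFC.sqrt_mul_sqrt_self S hS.posSemidef.nonneg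
  have hdet : IsUnit R.det := by
    have h : IsUnit S.det := hS.det_pos.ne'.isUnit
    rw [← hRR, Matrix.det_mul] at h
    exact isUnit_of_mul_isUnit_left h
  have h1 : R * R⁻¹ = 1 := Matrix.mul_nonsing_inv R hdet
  have h2 : R⁻¹ * R = 1 := Matrix.nonsing_inv_mul R hdet
  have hRsa : R.IsHermitian := (CFC.sqrt_nonneg S).isSelfAdjoint
  have hsa : IsSelfAdjoint (R⁻¹) := hRsa.inv
  have hinv : R⁻¹ * R⁻¹ = S⁻¹ := by rw [← hRR, Matrix.mul_inv_rev]
  have hcomp : ∀ A B : Matrix (Fin N) (Fin N) ℝ, A * B = 1 → ∀ v,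
      Matrix.toEuclideanCLM (𝕜 := ℝ) A (Matrix.toEuclideanCLM (𝕜 := ℝ) B v) = v := by
    intro A B hAB v
    rw [← mul_apply_eq_comp, ← map_mul, hAB, map_one, one_apply_eq_self]
  let L : EuclideanSpace ℝ (Fin N) ≃L[ℝ] EuclideanSpace ℝ (Fin N) :=
    ContinuousLinearEquiv.equivOfInverse (Matrix.toEuclideanCLM (𝕜 := ℝ) R)
      (Matrix.toEuclideanCLM (𝕜 := ℝ) R⁻¹) (hcomp _ _ h2) (hcomp _ _ h1)
  refine ⟨L, fun v => ?_, ?_⟩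
  · change covNorm S v = ‖Matrix.toEuclideanCLM (𝕜 := ℝ) R⁻¹ v‖
    have hsa' : IsSelfAdjoint (Matrix.toEuclideanCLM (n := Fin N) (𝕜 := ℝ) R⁻¹) := hsa.map _
    rw [covNorm, ← Matrix.inner_toEuclideanCLM, ← hinv, map_mul, mul_apply_eq_comp,
      ← ContinuousLinearMap.adjoint_inner_left, hsa'.adjoint_eq, real_inner_self_eq_norm_sq,
      Real.sqrt_sq (norm_nonneg _)]
  · rw [multivariateGaussian]
    congr 1
    ext1 v
    rw [zero_add]
    rfl

/-- The density of the standard Gaussian, identified by its characteristic function. -/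
theorem exists_stdGaussian_eq_withDensity (E : Type*) [NormedAddCommGroup E]
    [InnerProductSpace ℝ E] [FiniteDimensional ℝ E] [MeasurableSpace E] [BorelSpace E] :
    ∃ K : ℝ, stdGaussian E =
      volume.withDensity fun x => ENNReal.ofReal (K * Real.exp (-‖x‖ ^ 2 / 2)) := by
  -- The normalising constant `I` is left as an integral: the Gaussian Fourier integral at frequency
  -- zero evaluates it in the form in which it occurs at frequency `t`.
  set I : ℝ := ∫ x : E, Real.exp (-‖x‖ ^ 2 / 2) with hI
  have hb : 0 < (1 / 2 : ℂ).re := by norm_num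
  have hexp : ∀ x : E, (Real.exp (-‖x‖ ^ 2 / 2) : ℂ) = Complex.exp (-(1 / 2 : ℂ) * ‖x‖ ^ 2) := by
    intro x
    push_cast
    congr 1
    ring
  have hint : Integrable (fun x : E => Real.exp (-‖x‖ ^ 2 / 2)) := by
    have h := GaussianFourier.integrable_cexp_neg_mul_sq_norm_add hb 0 (0 : E)
    simp only [zero_mul, add_zero, ← hexp] at h
    refine h.norm.congr (Eventually.of_forall fun x => ?_)
    change ‖(Real.exp (-‖x‖ ^ 2 / 2) : ℂ)‖ = Real.exp (-‖x‖ ^ 2 / 2)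
    rw [Complex.norm_real, Real.norm_of_nonneg (Real.exp_pos _).le]
  have hIpos : 0 < I := integral_exp_pos hint
  have hP := GaussianFourier.integral_cexp_neg_mul_sq_norm_add hb 0 (0 : E)
  simp only [zero_mul, add_zero, ← hexp, integral_complex_ofReal, ← hI] at hP
  simp only [ne_eq, OfNat.ofNat_ne_zero, not_false_eq_true, zero_pow, zero_mul, zero_div,
    Complex.exp_zero, mul_one] at hP
  refine ⟨I⁻¹, ?_⟩
  have hint' : Integrable (fun x : E => I⁻¹ * Real.exp (-‖x‖ ^ 2 / 2)) := hint.const_mul _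
  have := isFiniteMeasure_withDensity_ofReal hint'.2
  have hmeas : Measurable fun x : E => ENNReal.ofReal (I⁻¹ * Real.exp (-‖x‖ ^ 2 / 2)) := by
    fun_prop
  refine Measure.ext_of_charFun ?_
  ext t
  rw [charFun_stdGaussian, charFun_apply, integral_withDensity_eq_integral_toReal_smul hmeas
    (Eventually.of_forall fun _ => ENNReal.ofReal_lt_top)]
  have hfun : ∀ x : E, (ENNReal.ofReal (I⁻¹ * Real.exp (-‖x‖ ^ 2 / 2))).toReal •
      Complex.exp (inner ℝ x t * Complex.I) =
        (I : ℂ)⁻¹ * Complex.exp (-(1 / 2 : ℂ) * ‖x‖ ^ 2 + Complex.I * inner ℝ t x) := by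
    intro x
    rw [ENNReal.toReal_ofReal (by positivity), Complex.real_smul, Complex.ofReal_mul, hexp,
      Complex.ofReal_inv, mul_assoc, ← Complex.exp_add, real_inner_comm, mul_comm Complex.I]
  simp only [hfun]
  rw [integral_const_mul, GaussianFourier.integral_cexp_neg_mul_sq_norm_add hb, ← hP, ← mul_assoc,
    inv_mul_cancel₀ (by exact_mod_cast hIpos.ne'), one_mul, Complex.I_sq]
  congr 1
  ring

/-- The Gaussian law has a density proportional to `exp (-|v|_Σ ^ 2 / 2)` with respect to a
translation-invariant measure, the image of Lebesgue measure under the square root of `Σ`. -/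
theorem exists_multivariateGaussian_eq_withDensity {N : ℕ} {S : Matrix (Fin N) (Fin N) ℝ}
    (hS : S.PosDef) : ∃ (K : ℝ) (μ₀ : Measure (EuclideanSpace ℝ (Fin N))),
      SFinite μ₀ ∧ μ₀.IsAddLeftInvariant ∧ multivariateGaussian 0 S =
        μ₀.withDensity fun v => ENNReal.ofReal (K * Real.exp (-covNorm S v ^ 2 / 2)) := by
  obtain ⟨L, hL, hmap⟩ := exists_equiv_covNorm hS
  obtain ⟨K, hK⟩ := exists_stdGaussian_eq_withDensity (EuclideanSpace ℝ (Fin N))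
  have hhaar : (Measure.map L (volume : Measure (EuclideanSpace ℝ (Fin N)))).IsAddHaarMeasure :=
    L.isAddHaarMeasure_map volume
  refine ⟨K, Measure.map L volume, inferInstance, inferInstance, ?_⟩
  have hLm : Measurable L := L.continuous.measurable
  have hg : Measurable fun v => ENNReal.ofReal (K * Real.exp (-covNorm S v ^ 2 / 2)) := by
    simp only [hL]
    have := L.symm.continuous.measurable
    fun_prop
  rw [hmap, hK]
  ext A hA
  rw [Measure.map_apply hLm hA, withDensity_apply _ (hLm hA), withDensity_apply _ hA,
    setLIntegral_map hA hg hLm]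
  simp [hL]

theorem continuous_covNorm {N : ℕ} {S : Matrix (Fin N) (Fin N) ℝ} (hS : S.PosDef) :
    Continuous (covNorm S) := by
  obtain ⟨L, hL, -⟩ := exists_equiv_covNorm hS
  rw [funext hL]
  exact L.symm.continuous.norm

theorem abs_covNorm_sub_le {N : ℕ} {S : Matrix (Fin N) (Fin N) ℝ} (hS : S.PosDef)
    (a b : EuclideanSpace ℝ (Fin N)) : |covNorm S a - covNorm S b| ≤ covNorm S (a - b) := by
  obtain ⟨L, hL, -⟩ := exists_equiv_covNorm hS
  rw [hL, hL, hL, map_sub]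
  exact abs_norm_sub_norm_le _ _

/-! ### The likelihood as a function of the data -/

section Likelihood

variable {U : Type*} {N : ℕ} {S : Matrix (Fin N) (Fin N) ℝ} {G : U → EuclideanSpace ℝ (Fin N)}

theorem misfit_nonneg (u : U) (δ : EuclideanSpace ℝ (Fin N)) : 0 ≤ misfit S G u δ := by
  unfold misfit; positivity

theorem abs_exp_neg_sq_sub_le (x y : ℝ) :
    |Real.exp (-x ^ 2 / 4) - Real.exp (-y ^ 2 / 4)| ≤ |x - y| := by
  have hderiv : ∀ t : ℝ, HasDerivAt (fun t => Real.exp (-t ^ 2 / 4))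
      (Real.exp (-t ^ 2 / 4) * (-t / 2)) t := by
    intro t
    have h : HasDerivAt (fun t : ℝ => -t ^ 2 / 4) (-t / 2) t := by
      refine (((hasDerivAt_pow 2 t).neg).div_const 4).congr_deriv ?_
      norm_num
      ring
    exact h.exp
  have hbound : ∀ t : ℝ, ‖Real.exp (-t ^ 2 / 4) * (-t / 2)‖ ≤ 1 := by
    intro t
    have h1 : |t| / 2 ≤ Real.exp (t ^ 2 / 4) := by
      have := Real.add_one_le_exp (t ^ 2 / 4)
      nlinarith [sq_nonneg (|t| - 1), sq_abs t]
    rw [norm_mul, Real.norm_of_nonneg (Real.exp_pos _).le, Real.norm_eq_abs, abs_div, abs_neg,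
      abs_two]
    calc Real.exp (-t ^ 2 / 4) * (|t| / 2)
        ≤ Real.exp (-t ^ 2 / 4) * Real.exp (t ^ 2 / 4) :=
          mul_le_mul_of_nonneg_left h1 (Real.exp_pos _).le
      _ = 1 := by rw [← Real.exp_add]; ring_nf; exact Real.exp_zero
  have := convex_univ.norm_image_sub_le_of_norm_hasDerivWithin_le
    (fun t _ => (hderiv t).hasDerivWithinAt) (fun t _ => hbound t) (Set.mem_univ y) (Set.mem_univ x)
  simpa using this

/-- The square root of the likelihood is Lipschitz in the data with constant one, uniformly in the
parameter: no moment of `G` enters, because `t ↦ exp (-t ^ 2 / 4)` is Lipschitz. -/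
theorem abs_exp_neg_misfit_div_two_sub_le (hS : S.PosDef) (u : U)
    (δ δ' : EuclideanSpace ℝ (Fin N)) :
    |Real.exp (-misfit S G u δ / 2) - Real.exp (-misfit S G u δ' / 2)| ≤ covNorm S (δ - δ') := by
  have h := abs_exp_neg_sq_sub_le (covNorm S (δ - G u)) (covNorm S (δ' - G u))
  have h' := abs_covNorm_sub_le hS (δ - G u) (δ' - G u)
  rw [sub_sub_sub_cancel_right] at h'
  have e : ∀ δ, -misfit S G u δ / 2 = -covNorm S (δ - G u) ^ 2 / 4 := fun δ => by
    rw [misfit]; ring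
  rw [e, e]
  exact h.trans h'

theorem exp_half_sq (x : ℝ) : Real.exp (x / 2) ^ 2 = Real.exp x := by
  rw [← Real.exp_nat_mul]; congr 1; push_cast; ring

theorem exp_neg_misfit_div_two_le_one (u : U) (δ : EuclideanSpace ℝ (Fin N)) :
    Real.exp (-misfit S G u δ / 2) ≤ 1 :=
  Real.exp_le_one_iff.2 (by linarith [misfit_nonneg (S := S) (G := G) u δ])

/-! ### The posterior as a regular conditional law -/

section Bayes

variable [MeasurableSpace U] {γ : Measure U}

theorem measurable_uncurry_misfit (hS : S.PosDef) (hG : Measurable G) :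
    Measurable fun q : U × EuclideanSpace ℝ (Fin N) => misfit S G q.1 q.2 := by
  unfold misfit
  have h1 : Measurable fun q : U × EuclideanSpace ℝ (Fin N) => q.2 - G q.1 :=
    measurable_snd.sub (hG.comp measurable_fst)
  exact (((continuous_covNorm hS).measurable.comp h1).pow_const 2).div_const 2

theorem measurable_misfit (hS : S.PosDef) (hG : Measurable G) (δ : EuclideanSpace ℝ (Fin N)) :
    Measurable fun u => misfit S G u δ := by
  unfold misfit
  exact (((continuous_covNorm hS).measurable.comp (hG.const_sub δ)).pow_const 2).div_const 2

theorem integrable_exp_neg_misfit [IsProbabilityMeasure γ] (hS : S.PosDef) (hG : Measurable G)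
    (δ : EuclideanSpace ℝ (Fin N)) : Integrable (fun u => Real.exp (-misfit S G u δ)) γ := by
  refine Integrable.of_bound (measurable_misfit hS hG δ).neg.exp.aestronglyMeasurable 1
    (Eventually.of_forall fun u => ?_)
  rw [Real.norm_of_nonneg (Real.exp_pos _).le]
  exact Real.exp_le_one_iff.2 (neg_nonpos.2 (misfit_nonneg u δ))

theorem normConst_pos [IsProbabilityMeasure γ] (hS : S.PosDef) (hG : Measurable G)
    (δ : EuclideanSpace ℝ (Fin N)) : 0 < normConst γ S G δ :=
  integral_exp_pos (integrable_exp_neg_misfit hS hG δ)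

theorem posteriorMeasure_apply (δ : EuclideanSpace ℝ (Fin N)) {A : Set U} (hA : MeasurableSet A) :
    posteriorMeasure γ S G δ A =
      ∫⁻ u in A, ENNReal.ofReal (Real.exp (-misfit S G u δ) / normConst γ S G δ) ∂γ :=
  withDensity_apply _ hA

theorem ofReal_normConst_mul_posteriorMeasure [IsProbabilityMeasure γ] (hS : S.PosDef)
    (hG : Measurable G) (δ : EuclideanSpace ℝ (Fin N)) {A : Set U} (hA : MeasurableSet A) :
    ENNReal.ofReal (normConst γ S G δ) * posteriorMeasure γ S G δ A =
      ∫⁻ u in A, ENNReal.ofReal (Real.exp (-misfit S G u δ)) ∂γ := by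
  have hZ := normConst_pos (γ := γ) hS hG δ
  have hm : Measurable fun u =>
      ENNReal.ofReal (Real.exp (-misfit S G u δ) / normConst γ S G δ) :=
    ((measurable_misfit hS hG δ).neg.exp.div_const _).ennreal_ofReal
  rw [posteriorMeasure_apply δ hA, ← lintegral_const_mul _ hm]
  refine lintegral_congr fun u => ?_
  rw [← ENNReal.ofReal_mul hZ.le, mul_div_cancel₀ _ hZ.ne']

theorem lintegral_exp_neg_misfit [IsProbabilityMeasure γ] (hS : S.PosDef) (hG : Measurable G)
    (δ : EuclideanSpace ℝ (Fin N)) :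
    ∫⁻ u, ENNReal.ofReal (Real.exp (-misfit S G u δ)) ∂γ = ENNReal.ofReal (normConst γ S G δ) :=
  (ofReal_integral_eq_lintegral_ofReal (integrable_exp_neg_misfit hS hG δ)
    (Eventually.of_forall fun _ => (Real.exp_pos _).le)).symm

theorem isProbabilityMeasure_posteriorMeasure [IsProbabilityMeasure γ] (hS : S.PosDef)
    (hG : Measurable G) (δ : EuclideanSpace ℝ (Fin N)) :
    IsProbabilityMeasure (posteriorMeasure γ S G δ) := by
  have h := ofReal_normConst_mul_posteriorMeasure (γ := γ) hS hG δ MeasurableSet.univ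
  rw [Measure.restrict_univ, lintegral_exp_neg_misfit hS hG] at h
  have hZ := normConst_pos (γ := γ) hS hG δ
  refine ⟨(ENNReal.mul_right_inj (ENNReal.ofReal_pos.2 hZ).ne' ENNReal.ofReal_ne_top).1 ?_⟩
  rw [h, mul_one]

theorem measurable_posteriorMeasure [IsProbabilityMeasure γ] (hS : S.PosDef)
    (hG : Measurable G) : Measurable (posteriorMeasure γ S G) := by
  have hexp : Measurable fun q : U × EuclideanSpace ℝ (Fin N) =>
      Real.exp (-misfit S G q.1 q.2) := (measurable_uncurry_misfit hS hG).neg.exp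
  have hZ : Measurable fun δ => normConst γ S G δ :=
    (hexp.stronglyMeasurable.integral_prod_left').measurable
  refine Measure.measurable_of_measurable_coe _ fun A hA => ?_
  simp only [posteriorMeasure_apply _ hA]
  exact Measurable.lintegral_prod_left'
    (f := fun q : U × EuclideanSpace ℝ (Fin N) =>
      ENNReal.ofReal (Real.exp (-misfit S G q.1 q.2) / normConst γ S G q.2))
    (hexp.div (hZ.comp measurable_snd)).ennreal_ofReal

/-- The joint law of the parameter and the observation, in terms of the density of the noise. -/
theorem lintegral_observation [IsProbabilityMeasure γ] (hG : Measurable G)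
    {μ₀ : Measure (EuclideanSpace ℝ (Fin N))} [SFinite μ₀] [μ₀.IsAddLeftInvariant]
    {ρ : EuclideanSpace ℝ (Fin N) → ℝ≥0∞} (hρ : Measurable ρ)
    [SFinite (μ₀.withDensity ρ)]
    {F : U × EuclideanSpace ℝ (Fin N) → ℝ≥0∞} (hF : Measurable F) :
    ∫⁻ q, F (q.1, G q.1 + q.2) ∂(γ.prod (μ₀.withDensity ρ)) =
      ∫⁻ δ, ∫⁻ u, ρ (δ - G u) * F (u, δ) ∂γ ∂μ₀ := by
  have hF' : Measurable fun q : U × EuclideanSpace ℝ (Fin N) => F (q.1, G q.1 + q.2) :=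
    hF.comp (measurable_fst.prodMk ((hG.comp measurable_fst).add measurable_snd))
  rw [lintegral_prod _ hF'.aemeasurable]
  refine Eq.trans ?_ (lintegral_lintegral_swap ?_).symm
  · refine lintegral_congr fun u => ?_
    have hFu : Measurable fun v => F (u, G u + v) := hF'.comp measurable_prodMk_left
    rw [lintegral_withDensity_eq_lintegral_mul _ hρ hFu,
      ← lintegral_add_left_eq_self (μ := μ₀) (fun δ => ρ (δ - G u) * F (u, δ)) (G u)]
    simp [add_sub_cancel_left]
  · refine Measurable.aemeasurable ?_
    exact (hρ.comp (measurable_fst.sub (hG.comp measurable_snd))).mul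
      (hF.comp measurable_swap)

/-- Bayes' formula. -/
theorem isConditionalLaw_posteriorMeasure [IsProbabilityMeasure γ] (hS : S.PosDef)
    (hG : Measurable G) :
    IsConditionalLaw γ (multivariateGaussian 0 S) G (posteriorMeasure γ S G) := by
  refine ⟨isProbabilityMeasure_posteriorMeasure hS hG, measurable_posteriorMeasure hS hG, ?_⟩
  intro A B hA hB
  obtain ⟨K, μ₀, hsf, hinv, hν⟩ := exists_multivariateGaussian_eq_withDensity hS
  have hρ : Measurable fun v => ENNReal.ofReal (K * Real.exp (-covNorm S v ^ 2 / 2)) := by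
    have := (continuous_covNorm hS).measurable
    fun_prop
  have hobs : Measurable fun q : U × EuclideanSpace ℝ (Fin N) => G q.1 + q.2 :=
    (hG.comp measurable_fst).add measurable_snd
  have hBm : MeasurableSet {q : U × EuclideanSpace ℝ (Fin N) | G q.1 + q.2 ∈ B} := hobs hB
  have hκ : Measurable fun δ => posteriorMeasure γ S G δ A :=
    (Measure.measurable_coe hA).comp (measurable_posteriorMeasure hS hG)
  have hdens : ∀ (u : U) (δ : EuclideanSpace ℝ (Fin N)),
      ENNReal.ofReal (K * Real.exp (-covNorm S (δ - G u) ^ 2 / 2)) =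
        ENNReal.ofReal (Real.exp (-misfit S G u δ)) * ENNReal.ofReal K := by
    intro u δ
    rw [← ENNReal.ofReal_mul (Real.exp_pos _).le, mul_comm, misfit, neg_div]
  have hm : ∀ δ, Measurable fun u => ENNReal.ofReal (Real.exp (-misfit S G u δ)) := fun δ =>
    (measurable_misfit hS hG δ).neg.exp.ennreal_ofReal
  have : SFinite (μ₀.withDensity fun v =>
      ENNReal.ofReal (K * Real.exp (-covNorm S v ^ 2 / 2))) := by
    rw [← hν]; infer_instance
  rw [hν]
  have hleft := lintegral_observation (γ := γ) (μ₀ := μ₀) hG hρ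
    (F := (A ×ˢ B).indicator 1) (measurable_one.indicator (hA.prod hB))
  have hright := lintegral_observation (γ := γ) (μ₀ := μ₀) hG hρ
    (F := fun q => B.indicator (fun δ => posteriorMeasure γ S G δ A) q.2)
    ((hκ.indicator hB).comp measurable_snd)
  calc (γ.prod _) {q | G q.1 + q.2 ∈ B ∧ q.1 ∈ A}
      = ∫⁻ q, (A ×ˢ B).indicator 1 (q.1, G q.1 + q.2) ∂(γ.prod _) := by
        have hset : {q : U × EuclideanSpace ℝ (Fin N) | G q.1 + q.2 ∈ B ∧ q.1 ∈ A} =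
            {q | G q.1 + q.2 ∈ B} ∩ Prod.fst ⁻¹' A := rfl
        rw [hset, ← lintegral_indicator_one (hBm.inter (measurable_fst hA))]
        refine lintegral_congr fun q => ?_
        by_cases h1 : q.1 ∈ A <;> by_cases h2 : G q.1 + q.2 ∈ B <;>
          simp [Set.indicator, h1, h2]
    _ = _ := hleft
    _ = _ := by
        refine lintegral_congr fun δ => ?_
        by_cases hδ : δ ∈ B
        · have h1 : ∀ u, ENNReal.ofReal (K * Real.exp (-covNorm S (δ - G u) ^ 2 / 2)) *
              (A ×ˢ B).indicator 1 (u, δ) =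
              A.indicator (fun u => ENNReal.ofReal (Real.exp (-misfit S G u δ))) u *
                ENNReal.ofReal K := by
            intro u
            by_cases hu : u ∈ A <;> simp [hdens, hu, hδ]
          rw [lintegral_congr h1]
          simp only [hdens, Set.indicator_of_mem hδ]
          rw [lintegral_mul_const _ ((hm δ).indicator hA), lintegral_indicator hA,
            ← ofReal_normConst_mul_posteriorMeasure hS hG δ hA,
            lintegral_mul_const _ ((hm δ).mul_const _), lintegral_mul_const _ (hm δ),
            lintegral_exp_neg_misfit hS hG]
          ring
        · simp [hδ]
    _ = _ := hright.symm
    _ = ∫⁻ q in {q | G q.1 + q.2 ∈ B}, posteriorMeasure γ S G (G q.1 + q.2) A ∂(γ.prod _) := by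
        rw [← lintegral_indicator hBm]
        rfl

/-! ### The Hellinger estimate -/

theorem abs_normConst_sub_le [IsProbabilityMeasure γ] (hS : S.PosDef) (hG : Measurable G)
    (δ δ' : EuclideanSpace ℝ (Fin N)) :
    |normConst γ S G δ - normConst γ S G δ'| ≤ 2 * covNorm S (δ - δ') := by
  rw [normConst, normConst, ← integral_sub (integrable_exp_neg_misfit hS hG δ)
    (integrable_exp_neg_misfit hS hG δ'), ← Real.norm_eq_abs]
  refine (norm_integral_le_of_norm_le_const (C := 2 * covNorm S (δ - δ'))
    (Eventually.of_forall fun u => ?_)).trans_eq (by simp)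
  have h := abs_exp_neg_misfit_div_two_sub_le (G := G) hS u δ δ'
  have h1 := exp_neg_misfit_div_two_le_one (S := S) (G := G) u δ
  have h2 := exp_neg_misfit_div_two_le_one (S := S) (G := G) u δ'
  rw [← exp_half_sq (-misfit S G u δ), ← exp_half_sq (-misfit S G u δ'), sq_sub_sq, norm_mul,
    Real.norm_of_nonneg (by positivity), Real.norm_eq_abs]
  exact mul_le_mul (by linarith) h (abs_nonneg _) two_pos.le

/-- Stability of normalising: `m ^ 2` and `m' ^ 2` are the unnormalised densities, `Z` and `Z'`
their integrals. -/
theorem abs_div_sqrt_sub_div_sqrt_le {a t m m' Z Z' : ℝ} (ha : 0 < a) (hZ : a ^ 2 ≤ Z)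
    (hZ' : a ^ 2 ≤ Z') (hm0 : 0 ≤ m') (hm1 : m' ≤ 1) (hm : |m - m'| ≤ t)
    (hZZ : |Z - Z'| ≤ 2 * t) :
    |m / √Z - m' / √Z'| ≤ (1 / a + 1 / a ^ 3) * t := by
  have hq : a ≤ √Z := Real.le_sqrt_of_sq_le hZ
  have hq' : a ≤ √Z' := Real.le_sqrt_of_sq_le hZ'
  have hs : √Z ^ 2 = Z := Real.sq_sqrt ((sq_nonneg a).trans hZ)
  have hs' : √Z' ^ 2 = Z' := Real.sq_sqrt ((sq_nonneg a).trans hZ')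
  set q := √Z
  set q' := √Z'
  have hq0 : 0 < q := ha.trans_le hq
  have hq0' : 0 < q' := ha.trans_le hq'
  have ht : 0 ≤ t := (abs_nonneg _).trans hm
  have hqq : |q - q'| ≤ t / a := by
    rw [← hs, ← hs', sq_sub_sq, abs_mul, abs_of_pos (by positivity)] at hZZ
    rw [le_div_iff₀ ha]
    have : 2 * a * |q - q'| ≤ (q + q') * |q - q'| :=
      mul_le_mul_of_nonneg_right (by linarith) (abs_nonneg _)
    linarith
  have hsplit : m / q - m' / q' = (m - m') / q + m' * (q' - q) / (q * q') := by
    field_simp; ring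
  have h1 : |(m - m') / q| ≤ t / a := by
    rw [abs_div, abs_of_pos hq0]
    gcongr
  have h2 : |m' * (q' - q) / (q * q')| ≤ 1 * (t / a) / (a * a) := by
    rw [abs_div, abs_mul, abs_of_nonneg hm0, abs_of_pos (mul_pos hq0 hq0'), abs_sub_comm]
    gcongr
  rw [hsplit]
  refine (abs_add_le _ _).trans ((add_le_add h1 h2).trans_eq ?_)
  field_simp

theorem hellingerDist_posteriorMeasure_le [IsProbabilityMeasure γ] (hS : S.PosDef)
    (hG : Measurable G) {a : ℝ} (ha : 0 < a) {δ δ' : EuclideanSpace ℝ (Fin N)}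
    (hδ : a ^ 2 ≤ normConst γ S G δ) (hδ' : a ^ 2 ≤ normConst γ S G δ') :
    hellingerDist γ (posteriorMeasure γ S G δ) (posteriorMeasure γ S G δ') ≤
      (1 / a + 1 / a ^ 3) * covNorm S (δ - δ') := by
  have ht : 0 ≤ covNorm S (δ - δ') := Real.sqrt_nonneg _
  have hrn : ∀ δ, ∀ᵐ u ∂γ, Real.sqrt ((posteriorMeasure γ S G δ).rnDeriv γ u).toReal =
      Real.exp (-misfit S G u δ / 2) / √(normConst γ S G δ) := by
    intro δ
    have hm : Measurable fun u =>
        ENNReal.ofReal (Real.exp (-misfit S G u δ) / normConst γ S G δ) :=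
      ((measurable_misfit hS hG δ).neg.exp.div_const _).ennreal_ofReal
    filter_upwards [Measure.rnDeriv_withDensity γ hm] with u hu
    have hZ := normConst_pos (γ := γ) hS hG δ
    rw [posteriorMeasure, hu, ENNReal.toReal_ofReal (by positivity),
      Real.sqrt_div (Real.exp_pos _).le, ← exp_half_sq, Real.sqrt_sq (Real.exp_pos _).le]
  set C := (1 / a + 1 / a ^ 3) * covNorm S (δ - δ') with hC
  have hC0 : 0 ≤ C := by positivity
  have hint : ‖∫ u, (Real.sqrt ((posteriorMeasure γ S G δ).rnDeriv γ u).toReal -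
      Real.sqrt ((posteriorMeasure γ S G δ').rnDeriv γ u).toReal) ^ 2 ∂γ‖ ≤ C ^ 2 := by
    refine (norm_integral_le_of_norm_le_const (C := C ^ 2) ?_).trans_eq (by simp)
    filter_upwards [hrn δ, hrn δ'] with u hu hu'
    rw [hu, hu', norm_pow, Real.norm_eq_abs]
    refine pow_le_pow_left₀ (abs_nonneg _) ?_ 2
    exact abs_div_sqrt_sub_div_sqrt_le ha hδ hδ' (Real.exp_pos _).le
      (exp_neg_misfit_div_two_le_one u δ') (abs_exp_neg_misfit_div_two_sub_le hS u δ δ')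
      (abs_normConst_sub_le hS hG δ δ')
  refine (Real.sqrt_le_sqrt (?_ : _ ≤ C ^ 2)).trans_eq (Real.sqrt_sq hC0)
  have := (le_abs_self _).trans hint
  nlinarith [sq_nonneg C]

/-- On a ball of data the normalising constant, being continuous and positive, has a positive lower
bound. -/
theorem exists_sq_le_normConst [IsProbabilityMeasure γ] (hS : S.PosDef) (hG : Measurable G)
    (r : ℝ) : ∃ a : ℝ, 0 < a ∧ ∀ δ, ‖δ‖ < r → a ^ 2 ≤ normConst γ S G δ := by
  have hcont : Continuous (normConst γ S G) := by
    refine continuous_iff_continuousAt.2 fun δ => tendsto_iff_dist_tendsto_zero.2 ?_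
    have hlim : Tendsto (fun δ' => 2 * covNorm S (δ' - δ)) (𝓝 δ) (𝓝 0) := by
      have hc : Continuous fun δ' => 2 * covNorm S (δ' - δ) :=
        continuous_const.mul ((continuous_covNorm hS).comp (continuous_id.sub continuous_const))
      simpa [covNorm_zero] using hc.tendsto δ
    exact squeeze_zero (fun _ => dist_nonneg) (fun δ' => abs_normConst_sub_le hS hG δ' δ) hlim
  rcases lt_or_ge r 0 with hr | hr
  · exact ⟨1, one_pos, fun δ hδ => absurd (hδ.trans hr) (norm_nonneg δ).not_gt⟩
  obtain ⟨δ₀, -, hδ₀⟩ := (isCompact_closedBall (0 : EuclideanSpace ℝ (Fin N)) r).exists_isMinOn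
    ⟨0, by simpa using hr⟩ hcont.continuousOn
  have hZ := normConst_pos (γ := γ) hS hG δ₀
  refine ⟨√(normConst γ S G δ₀), Real.sqrt_pos.2 hZ, fun δ hδ => ?_⟩
  rw [Real.sq_sqrt hZ.le]
  exact hδ₀ (by simpa using hδ.le)

end Bayes

end Likelihood

end LogNormalEikonal

theorem mainTheorem2 {d N : ℕ} (Ω : Set (EuclideanSpace ℝ (Fin d)))
    (hΩ : IsLipschitzDomain Ω) (hΩb : Bornology.IsBounded Ω)
    (x₀ : EuclideanSpace ℝ (Fin d)) (hx₀ : x₀ ∈ Ω)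
    (sStar sBar : EuclideanSpace ℝ (Fin d) → ℝ) (ψ : ℕ → EuclideanSpace ℝ (Fin d) → ℝ)
    (hsStar : MemLp sStar ∞ (volume.restrict Ω))
    (hsStar_nonneg : ∀ᵐ y ∂(volume.restrict Ω), 0 ≤ sStar y)
    (hsBar : MemLp sBar ∞ (volume.restrict Ω))
    (hψ : ∀ i, MemLp (ψ i) ∞ (volume.restrict Ω))
    (c₀ p : ℝ) (hp : 1 < p)
    (hdecay : ∀ i : ℕ, supNorm Ω (ψ i) < c₀ * ((i : ℝ) + 1) ^ (-p))
    (s : paramSpace Ω ψ → EuclideanSpace ℝ (Fin d) → ℝ)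
    (hs_cont : ∀ u, ContinuousOn (s u) (closure Ω))
    (hs : ∀ u, ∀ᵐ y ∂(volume.restrict Ω),
      s u y = sStar y + Real.exp (sBar y + ∑' i, (u : ℕ → ℝ) i * ψ i y))
    (x : Fin N → EuclideanSpace ℝ (Fin d)) (hx : ∀ i, x i ∈ closure Ω)
    (S : Matrix (Fin N) (Fin N) ℝ) (hS : S.PosDef) :
    (∀ u, ∃ T, IsEikonalSolution Ω x₀ (s u) T ∧
      ∀ T', IsEikonalSolution Ω x₀ (s u) T' → Set.EqOn T' T (closure Ω)) ∧
    ∀ T : paramSpace Ω ψ → EuclideanSpace ℝ (Fin d) → ℝ,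
      (∀ u, IsEikonalSolution Ω x₀ (s u) (T u)) →
      IsConditionalLaw (prior Ω ψ) (multivariateGaussian 0 S) (forwardMap T x)
        (posteriorMeasure (prior Ω ψ) S (forwardMap T x)) ∧
      ∀ r : ℝ, ∃ c : ℝ, ∀ δ δ' : EuclideanSpace ℝ (Fin N), ‖δ‖ < r → ‖δ'‖ < r →
        hellingerDist (prior Ω ψ) (posteriorMeasure (prior Ω ψ) S (forwardMap T x) δ)
          (posteriorMeasure (prior Ω ψ) S (forwardMap T x) δ') ≤ c * covNorm S (δ - δ') := by
  have hcone := hΩ.hasInteriorCones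
  have hopen := hΩ.isOpen
  have hpos := slowness_pos hopen hsStar_nonneg hsBar hψ hs_cont hs
  have hle := slowness_le hopen hsStar_nonneg hψ hs_cont hs
  refine ⟨fun u => ?_, fun T hT => ?_⟩
  · have hsol := isEikonalSolution_perronSolution hcone hopen hΩ.isConnected hΩb hx₀ (hs_cont u)
      fun y hy => (hpos u y hy).le
    have hcomp := fun {T₁ T₂ : EuclideanSpace ℝ (Fin d) → ℝ} =>
      IsEikonalSolution.le_of_le (T₁ := T₁) (T₂ := T₂) hcone hopen hΩb (hs_cont u) (hs_cont u)
        (hpos u) (fun _ _ => le_rfl) (x₀ := x₀)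
    exact ⟨_, hsol, fun T' hT' y hy => le_antisymm (hcomp hT' hsol y hy) (hcomp hsol hT' y hy)⟩
  · have hprob : IsProbabilityMeasure (prior Ω ψ) := isProbabilityMeasure_prior hp hdecay
    have hG : Measurable (forwardMap T x) := by
      refine (WithLp.measurable_toLp 2 _).comp (measurable_pi_lambda _ fun i => ?_)
      exact measurable_solution fun ι l v u hv =>
        tendsto_solution hcone hopen hΩb hs_cont hpos hle hT hv (hx i)
    refine ⟨isConditionalLaw_posteriorMeasure hS hG, fun r => ?_⟩
    obtain ⟨a, ha, hZ⟩ := exists_sq_le_normConst (γ := prior Ω ψ) hS hG r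
    exact ⟨_, fun δ δ' hδ hδ' => hellingerDist_posteriorMeasure_le hS hG ha (hZ δ hδ) (hZ δ' hδ')⟩
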